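/- Let $\mathsf{F}^{\mu}$ be the call-by-value $\lambda$-calculus with impredicative polymorphism and iso-recursive types. Its types are $\tau ::= \alpha \mid \mathsf{unit} \mid \mathsf{int} \mid \mathsf{bool} \mid \tau_1\times\tau_2 \mid \tau_1+\tau_2 \mid \tau_1\to\tau_2 \mid \forall\alpha.\tau \mid \exists\alpha.\tau \mid \mu\alpha.\tau$. Its terms are variables, $\langle\rangle$, integer literals, $\mathsf{true}$, $\mathsf{false}$, applications of primitive operations ($+,-,=,<,\le$ on the integers and any further operations that denote total functions on constants of base type), conditionals, pairs and projections, type-annotated sum injections and case analysis, $\lambda x{:}\tau.e$ and $e_1\,e_2$, $\Lambda\alpha.e$ and $e[\tau]$, pack and unpack for existential types, and fold and unfold for recursive types. Typing $\Gamma\vdash e:\tau$ is standard, and reduction $e\leadsto e'$ is the standard left-to-right call-by-value small-step reduction. Write $e\Downarrow v$ if $e\leadsto^{*}v$ and $v$ is a value, and $e\Downarrow$ if $e\Downarrow v$ for some $v$. For terms with $\Gamma\vdash e_1:\tau$ and $\Gamma\vdash e_2:\tau$, say that $e_1$ contextually approximates $e_2$ at type $\tau$, written $\Gamma\vdash e_1\preceq^{\mathit{ctx}}e_2:\tau$,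 if for every type $\tau'$ and every program context $C$ (a term with one hole, anywhere in it) that is well typed with hole of type $\tau$ in $\Gamma$ and result of type $\tau'$ in the empty typing context, $C[e_1]\Downarrow$ implies $C[e_2]\Downarrow$. **Theorem.** Let $\tau$ and $\sigma$ be closed types, and let $h,f,v,w$ be values with $\vdash h:\forall\alpha.\,\alpha\to\alpha\to\alpha$, $\vdash f:\tau\to\sigma$, $\vdash v:\tau$ and $\vdash w:\tau$. Then $$\vdash\; h[\sigma]\,(f\,v)\,(f\,w)\;\preceq^{\mathit{ctx}}\; f\,(h[\tau]\,v\,w)\;:\;\sigma .$$ If moreover $f$ is total, i.e. for every value $x$ with $\vdash x:\tau$ there is a value $y$ such that $f\,x\Downarrow y$, then also $$\vdash\; f\,(h[\tau]\,v\,w)\;\preceq^{\mathit{ctx}}\; h[\sigma]\,(f\,v)\,(f\,w)\;:\;\sigma .$$ -/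

import Mathlib

namespace FMu

/-! ## Types (de Bruijn indices for type variables) -/

inductive Ty : Type where
  | var (i : ℕ)
  | unit
  | int
  | bool
  | prod (τ₁ τ₂ : Ty)
  | sum (τ₁ τ₂ : Ty)
  | arr (τ₁ τ₂ : Ty)
  /-- `∀α. τ`; the body has one more type variable, index `0`. -/
  | all (τ : Ty)
  /-- `∃α. τ` -/
  | ex (τ : Ty)
  /-- `μα. τ` -/
  | mu (τ : Ty)

/-- Extension of a map on de Bruijn indices by a value for index `0`. -/
def scons {A : Type} (a : A) (g : ℕ → A) : ℕ → A
  | 0 => a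
  | n + 1 => g n

/-- A renaming carried under one binder. -/
def upRen (ξ : ℕ → ℕ) : ℕ → ℕ := scons 0 fun n => ξ n + 1

namespace Ty

def rename : Ty → (ℕ → ℕ) → Ty
  | var i, ξ => var (ξ i)
  | unit, _ => unit
  | int, _ => int
  | bool, _ => bool
  | prod τ₁ τ₂, ξ => prod (τ₁.rename ξ) (τ₂.rename ξ)
  | sum τ₁ τ₂, ξ => sum (τ₁.rename ξ) (τ₂.rename ξ)
  | arr τ₁ τ₂, ξ => arr (τ₁.rename ξ) (τ₂.rename ξ)
  | all τ, ξ => all (τ.rename (upRen ξ))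
  | ex τ, ξ => ex (τ.rename (upRen ξ))
  | mu τ, ξ => mu (τ.rename (upRen ξ))

/-- Weakening by one fresh type variable. -/
def shift (τ : Ty) : Ty := τ.rename Nat.succ

/-- A type substitution carried under one type binder. -/
def up (θ : ℕ → Ty) : ℕ → Ty := scons (var 0) fun n => (θ n).shift

/-- Simultaneous capture-avoiding substitution. -/
def subst : Ty → (ℕ → Ty) → Ty
  | var i, θ => θ i
  | unit, _ => unit
  | int, _ => int
  | bool, _ => bool
  | prod τ₁ τ₂, θ => prod (τ₁.subst θ) (τ₂.subst θ)
  | sum τ₁ τ₂, θ => sum (τ₁.subst θ) (τ₂.subst θ)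
  | arr τ₁ τ₂, θ => arr (τ₁.subst θ) (τ₂.subst θ)
  | all τ, θ => all (τ.subst (up θ))
  | ex τ, θ => ex (τ.subst (up θ))
  | mu τ, θ => mu (τ.subst (up θ))

/-- `τ[τ₁/α]`, where `α` is the variable with index `0` of `τ`. -/
def inst (τ τ₁ : Ty) : Ty := τ.subst (scons τ₁ var)

/-- `τ.WF Δ`: the free type variables of `τ` are among `0, …, Δ - 1`. -/
def WF : Ty → ℕ → Prop
  | var i, Δ => i < Δ
  | unit, _ => True
  | int, _ => True
  | bool, _ => True
  | prod τ₁ τ₂, Δ => τ₁.WF Δ ∧ τ₂.WF Δ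
  | sum τ₁ τ₂, Δ => τ₁.WF Δ ∧ τ₂.WF Δ
  | arr τ₁ τ₂, Δ => τ₁.WF Δ ∧ τ₂.WF Δ
  | all τ, Δ => τ.WF (Δ + 1)
  | ex τ, Δ => τ.WF (Δ + 1)
  | mu τ, Δ => τ.WF (Δ + 1)

end Ty

/-! ## Primitive operations -/

/-- Base types, at which primitive operations are typed. -/
inductive Base : Type where
  | unit
  | int
  | bool

namespace Base

def toTy : Base → Ty
  | unit => Ty.unit
  | int => Ty.int
  | bool => Ty.bool

/-- The set of constants of a base type. -/
def Val : Base → Type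
  | unit => Unit
  | int => ℤ
  | bool => Bool

end Base

/-- A collection of further primitive operations: each has finitely many arguments of base type,
a result of base type, and denotes a total function on the constants of these types. -/
structure PrimSig where
  Op : Type
  arity : Op → ℕ
  argTy : (o : Op) → Fin (arity o) → Base
  resTy : Op → Base
  interp : (o : Op) → ((i : Fin (arity o)) → (argTy o i).Val) → (resTy o).Val

/-- The primitive operations `+`, `-`, `=`, `<`, `≤` on integers, and those of `S`. -/
inductive PrimOp (S : PrimSig) : Type where
  | add
  | sub
  | eq
  | lt
  | le
  | other (o : S.Op)

namespace PrimOp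

variable {S : PrimSig}

def arity : PrimOp S → ℕ
  | add => 2
  | sub => 2
  | eq => 2
  | lt => 2
  | le => 2
  | other o => S.arity o

def argTy : (o : PrimOp S) → Fin o.arity → Base
  | add, _ => Base.int
  | sub, _ => Base.int
  | eq, _ => Base.int
  | lt, _ => Base.int
  | le, _ => Base.int
  | other o, i => S.argTy o i

def resTy : PrimOp S → Base
  | add => Base.int
  | sub => Base.int
  | eq => Base.bool
  | lt => Base.bool
  | le => Base.bool
  | other o => S.resTy o

def binary {A : Type} (g : ℤ → ℤ → A) (a : Fin 2 → ℤ) : A := g (a 0) (a 1)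

def interp : (o : PrimOp S) → ((i : Fin o.arity) → (o.argTy i).Val) → o.resTy.Val
  | add, a => binary (fun m n => m + n) a
  | sub, a => binary (fun m n => m - n) a
  | eq, a => binary (fun m n => decide (m = n)) a
  | lt, a => binary (fun m n => decide (m < n)) a
  | le, a => binary (fun m n => decide (m ≤ n)) a
  | other o, a => S.interp o a

end PrimOp

/-! ## Terms (separate de Bruijn indices for type variables and for term variables) -/

inductive Tm (S : PrimSig) : Type where
  | var (x : ℕ)
  | unit
  | int (n : ℤ)
  | op (o : PrimOp S) (args : Fin o.arity → Tm S)
  | tru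
  | fls
  | ite (e e₁ e₂ : Tm S)
  | pair (e₁ e₂ : Tm S)
  | fst (e : Tm S)
  | snd (e : Tm S)
  /-- `inl_τ e`, annotated with the whole sum type `τ` -/
  | inl (τ : Ty) (e : Tm S)
  | inr (τ : Ty) (e : Tm S)
  /-- `case e of inl x₁ ⇒ e₁ | inr x₂ ⇒ e₂`; each branch binds one term variable. -/
  | case (e e₁ e₂ : Tm S)
  /-- `λx:τ. e` -/
  | lam (τ : Ty) (e : Tm S)
  | app (e₁ e₂ : Tm S)
  /-- `Λα. e` -/
  | tlam (e : Tm S)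
  /-- `e[τ]` -/
  | tapp (e : Tm S) (τ : Ty)
  /-- `pack τ₁, e as ∃α. τ`; the type variable `α` is bound in `τ`. -/
  | pack (τ₁ : Ty) (e : Tm S) (τ : Ty)
  /-- `unpack e₁ as α, x in e₂`; `e₂` binds one type variable and one term variable. -/
  | unpack (e₁ e₂ : Tm S)
  /-- `fold_τ e` (also called roll), annotated with the whole recursive type `τ` -/
  | fold (τ : Ty) (e : Tm S)
  | unfold (e : Tm S)

/-- The literal term for a constant of base type. -/
def Base.toTm {S : PrimSig} : (b : Base) → b.Val → Tm S
  | Base.unit, _ => Tm.unit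
  | Base.int, n => Tm.int n
  | Base.bool, true => Tm.tru
  | Base.bool, false => Tm.fls

namespace Tm

variable {S : PrimSig}

/-- Simultaneous renaming: `ξ` acts on type variables, `ζ` on term variables. -/
def rename : Tm S → (ℕ → ℕ) → (ℕ → ℕ) → Tm S
  | var x, _, ζ => var (ζ x)
  | unit, _, _ => unit
  | int n, _, _ => int n
  | op o args, ξ, ζ => op o fun i => (args i).rename ξ ζ
  | tru, _, _ => tru
  | fls, _, _ => fls
  | ite e e₁ e₂, ξ, ζ => ite (e.rename ξ ζ) (e₁.rename ξ ζ) (e₂.rename ξ ζ)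
  | pair e₁ e₂, ξ, ζ => pair (e₁.rename ξ ζ) (e₂.rename ξ ζ)
  | fst e, ξ, ζ => fst (e.rename ξ ζ)
  | snd e, ξ, ζ => snd (e.rename ξ ζ)
  | inl τ e, ξ, ζ => inl (τ.rename ξ) (e.rename ξ ζ)
  | inr τ e, ξ, ζ => inr (τ.rename ξ) (e.rename ξ ζ)
  | case e e₁ e₂, ξ, ζ => case (e.rename ξ ζ) (e₁.rename ξ (upRen ζ)) (e₂.rename ξ (upRen ζ))
  | lam τ e, ξ, ζ => lam (τ.rename ξ) (e.rename ξ (upRen ζ))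
  | app e₁ e₂, ξ, ζ => app (e₁.rename ξ ζ) (e₂.rename ξ ζ)
  | tlam e, ξ, ζ => tlam (e.rename (upRen ξ) ζ)
  | tapp e τ, ξ, ζ => tapp (e.rename ξ ζ) (τ.rename ξ)
  | pack τ₁ e τ, ξ, ζ => pack (τ₁.rename ξ) (e.rename ξ ζ) (τ.rename (upRen ξ))
  | unpack e₁ e₂, ξ, ζ => unpack (e₁.rename ξ ζ) (e₂.rename (upRen ξ) (upRen ζ))
  | fold τ e, ξ, ζ => fold (τ.rename ξ) (e.rename ξ ζ)
  | unfold e, ξ, ζ => unfold (e.rename ξ ζ)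

/-- A term substitution carried under one term binder. -/
def up (γ : ℕ → Tm S) : ℕ → Tm S := scons (var 0) fun n => (γ n).rename id Nat.succ

/-- A term substitution carried under one type binder. -/
def tup (γ : ℕ → Tm S) : ℕ → Tm S := fun n => (γ n).rename Nat.succ id

/-- Simultaneous capture-avoiding substitution: `θ` for type variables, `γ` for term variables. -/
def subst : Tm S → (ℕ → Ty) → (ℕ → Tm S) → Tm S
  | var x, _, γ => γ x
  | unit, _, _ => unit
  | int n, _, _ => int n
  | op o args, θ, γ => op o fun i => (args i).subst θ γ
  | tru, _, _ => tru
  | fls, _, _ => fls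
  | ite e e₁ e₂, θ, γ => ite (e.subst θ γ) (e₁.subst θ γ) (e₂.subst θ γ)
  | pair e₁ e₂, θ, γ => pair (e₁.subst θ γ) (e₂.subst θ γ)
  | fst e, θ, γ => fst (e.subst θ γ)
  | snd e, θ, γ => snd (e.subst θ γ)
  | inl τ e, θ, γ => inl (τ.subst θ) (e.subst θ γ)
  | inr τ e, θ, γ => inr (τ.subst θ) (e.subst θ γ)
  | case e e₁ e₂, θ, γ => case (e.subst θ γ) (e₁.subst θ (up γ)) (e₂.subst θ (up γ))
  | lam τ e, θ, γ => lam (τ.subst θ) (e.subst θ (up γ))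
  | app e₁ e₂, θ, γ => app (e₁.subst θ γ) (e₂.subst θ γ)
  | tlam e, θ, γ => tlam (e.subst (Ty.up θ) (tup γ))
  | tapp e τ, θ, γ => tapp (e.subst θ γ) (τ.subst θ)
  | pack τ₁ e τ, θ, γ => pack (τ₁.subst θ) (e.subst θ γ) (τ.subst (Ty.up θ))
  | unpack e₁ e₂, θ, γ => unpack (e₁.subst θ γ) (e₂.subst (Ty.up θ) (up (tup γ)))
  | fold τ e, θ, γ => fold (τ.subst θ) (e.subst θ γ)
  | unfold e, θ, γ => unfold (e.subst θ γ)

/-- `e[v/x]`, where `x` is the term variable with index `0` of `e`. -/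
def inst (e v : Tm S) : Tm S := e.subst Ty.var (scons v var)

/-- `e[τ/α]`, where `α` is the type variable with index `0` of `e`. -/
def tinst (e : Tm S) (τ : Ty) : Tm S := e.subst (scons τ Ty.var) var

/-- `e[v/x][τ/α]` for the term variable `x` and the type variable `α` with index `0` of `e`
(`α` does not occur in `v`). -/
def unpackInst (e : Tm S) (τ : Ty) (v : Tm S) : Tm S := e.subst (scons τ Ty.var) (scons v var)

end Tm

/-! ## Dynamic semantics -/

section Dynamics

variable {S : PrimSig}

inductive IsValue : Tm S → Prop
  | var (x : ℕ) : IsValue (.var x)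
  | unit : IsValue .unit
  | int (n : ℤ) : IsValue (.int n)
  | tru : IsValue .tru
  | fls : IsValue .fls
  | pair {v₁ v₂ : Tm S} : IsValue v₁ → IsValue v₂ → IsValue (.pair v₁ v₂)
  | inl (τ : Ty) {v : Tm S} : IsValue v → IsValue (.inl τ v)
  | inr (τ : Ty) {v : Tm S} : IsValue v → IsValue (.inr τ v)
  | lam (τ : Ty) (e : Tm S) : IsValue (.lam τ e)
  | tlam (e : Tm S) : IsValue (.tlam e)
  | pack (τ₁ : Ty) {v : Tm S} (τ : Ty) : IsValue v → IsValue (.pack τ₁ v τ)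
  | fold (τ : Ty) {v : Tm S} : IsValue v → IsValue (.fold τ v)

/-- Left-to-right call-by-value evaluation contexts. -/
inductive EvalCtx (S : PrimSig) : Type where
  | hole
  /-- `o(v₁, …, vᵢ₋₁, E, eᵢ₊₁, …, eₙ)`; the component `args i` is not used. -/
  | op (o : PrimOp S) (i : Fin o.arity) (args : Fin o.arity → Tm S)
      (hv : ∀ j, j < i → IsValue (args j)) (E : EvalCtx S)
  | ite (E : EvalCtx S) (e₁ e₂ : Tm S)
  | pairL (E : EvalCtx S) (e₂ : Tm S)
  | pairR (v₁ : Tm S) (hv : IsValue v₁) (E : EvalCtx S)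
  | fst (E : EvalCtx S)
  | snd (E : EvalCtx S)
  | inl (τ : Ty) (E : EvalCtx S)
  | inr (τ : Ty) (E : EvalCtx S)
  | case (E : EvalCtx S) (e₁ e₂ : Tm S)
  | appL (E : EvalCtx S) (e : Tm S)
  | appR (v : Tm S) (hv : IsValue v) (E : EvalCtx S)
  | tapp (E : EvalCtx S) (τ : Ty)
  | pack (τ₁ : Ty) (E : EvalCtx S) (τ : Ty)
  | unpack (E : EvalCtx S) (e₂ : Tm S)
  | fold (τ : Ty) (E : EvalCtx S)
  | unfold (E : EvalCtx S)

/-- `E[e]` -/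
def EvalCtx.fill : EvalCtx S → Tm S → Tm S
  | hole, e => e
  | op o i args _ E, e => .op o (Function.update args i (E.fill e))
  | ite E e₁ e₂, e => .ite (E.fill e) e₁ e₂
  | pairL E e₂, e => .pair (E.fill e) e₂
  | pairR v₁ _ E, e => .pair v₁ (E.fill e)
  | fst E, e => .fst (E.fill e)
  | snd E, e => .snd (E.fill e)
  | inl τ E, e => .inl τ (E.fill e)
  | inr τ E, e => .inr τ (E.fill e)
  | case E e₁ e₂, e => .case (E.fill e) e₁ e₂
  | appL E e₂, e => .app (E.fill e) e₂
  | appR v _ E, e => .app v (E.fill e)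
  | tapp E τ, e => .tapp (E.fill e) τ
  | pack τ₁ E τ, e => .pack τ₁ (E.fill e) τ
  | unpack E e₂, e => .unpack (E.fill e) e₂
  | fold τ E, e => .fold τ (E.fill e)
  | unfold E, e => .unfold (E.fill e)

/-- Contraction of a redex. -/
inductive HeadStep : Tm S → Tm S → Prop
  | op (o : PrimOp S) (a : (i : Fin o.arity) → (o.argTy i).Val) :
      HeadStep (.op o fun i => (o.argTy i).toTm (a i)) (o.resTy.toTm (o.interp a))
  | iteTrue (e₁ e₂ : Tm S) : HeadStep (.ite .tru e₁ e₂) e₁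
  | iteFalse (e₁ e₂ : Tm S) : HeadStep (.ite .fls e₁ e₂) e₂
  | fst {v₁ v₂ : Tm S} : IsValue v₁ → IsValue v₂ → HeadStep (.fst (.pair v₁ v₂)) v₁
  | snd {v₁ v₂ : Tm S} : IsValue v₁ → IsValue v₂ → HeadStep (.snd (.pair v₁ v₂)) v₂
  | caseInl (τ : Ty) {v : Tm S} (e₁ e₂ : Tm S) : IsValue v →
      HeadStep (.case (.inl τ v) e₁ e₂) (e₁.inst v)
  | caseInr (τ : Ty) {v : Tm S} (e₁ e₂ : Tm S) : IsValue v →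
      HeadStep (.case (.inr τ v) e₁ e₂) (e₂.inst v)
  | beta (τ : Ty) (e : Tm S) {v : Tm S} : IsValue v →
      HeadStep (.app (.lam τ e) v) (e.inst v)
  | tbeta (e : Tm S) (τ : Ty) : HeadStep (.tapp (.tlam e) τ) (e.tinst τ)
  | unpack (τ : Ty) {v : Tm S} (τ₁ : Ty) (e : Tm S) : IsValue v →
      HeadStep (.unpack (.pack τ v τ₁) e) (e.unpackInst τ v)
  | unfold (τ : Ty) {v : Tm S} : IsValue v → HeadStep (.unfold (.fold τ v)) v

/-- The small-step reduction relation `e ⇝ e'`. -/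
inductive Step : Tm S → Tm S → Prop
  | head {e e' : Tm S} : HeadStep e e' → Step e e'
  | ctx (E : EvalCtx S) {e e' : Tm S} : Step e e' → Step (E.fill e) (E.fill e')

/-- `e ⇓ v`: `e` reduces in finitely many steps to the value `v`. -/
def EvalsTo (e v : Tm S) : Prop := Relation.ReflTransGen Step e v ∧ IsValue v

/-- `e ⇓` -/
def Terminates (e : Tm S) : Prop := ∃ v, EvalsTo e v

end Dynamics

/-! ## Static semantics

A typing context is a pair `Δ`, `Γ`: the number `Δ` of type variables in scope and the list `Γ` of
the types (over these type variables) of the term variables in scope. -/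

section Statics

variable {S : PrimSig}

/-- `Δ; Γ ⊢ e : τ` -/
inductive HasType : ℕ → List Ty → Tm S → Ty → Prop
  | var {Δ Γ x τ} : Γ[x]? = some τ → HasType Δ Γ (.var x) τ
  | unit {Δ Γ} : HasType Δ Γ .unit .unit
  | int {Δ Γ} (n : ℤ) : HasType Δ Γ (.int n) .int
  | op {Δ Γ} {o : PrimOp S} {args : Fin o.arity → Tm S} :
      (∀ i, HasType Δ Γ (args i) (o.argTy i).toTy) → HasType Δ Γ (.op o args) o.resTy.toTy
  | tru {Δ Γ} : HasType Δ Γ .tru .bool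
  | fls {Δ Γ} : HasType Δ Γ .fls .bool
  | ite {Δ Γ e e₁ e₂ τ} : HasType Δ Γ e .bool → HasType Δ Γ e₁ τ → HasType Δ Γ e₂ τ →
      HasType Δ Γ (.ite e e₁ e₂) τ
  | pair {Δ Γ e₁ e₂ τ₁ τ₂} : HasType Δ Γ e₁ τ₁ → HasType Δ Γ e₂ τ₂ →
      HasType Δ Γ (.pair e₁ e₂) (.prod τ₁ τ₂)
  | fst {Δ Γ e τ₁ τ₂} : HasType Δ Γ e (.prod τ₁ τ₂) → HasType Δ Γ (.fst e) τ₁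
  | snd {Δ Γ e τ₁ τ₂} : HasType Δ Γ e (.prod τ₁ τ₂) → HasType Δ Γ (.snd e) τ₂
  | inl {Δ Γ e τ₁ τ₂} : τ₂.WF Δ → HasType Δ Γ e τ₁ →
      HasType Δ Γ (.inl (.sum τ₁ τ₂) e) (.sum τ₁ τ₂)
  | inr {Δ Γ e τ₁ τ₂} : τ₁.WF Δ → HasType Δ Γ e τ₂ →
      HasType Δ Γ (.inr (.sum τ₁ τ₂) e) (.sum τ₁ τ₂)
  | case {Δ Γ e e₁ e₂ τ₁ τ₂ τ} : HasType Δ Γ e (.sum τ₁ τ₂) →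
      HasType Δ (τ₁ :: Γ) e₁ τ → HasType Δ (τ₂ :: Γ) e₂ τ → HasType Δ Γ (.case e e₁ e₂) τ
  | lam {Δ Γ e τ₁ τ₂} : τ₁.WF Δ → HasType Δ (τ₁ :: Γ) e τ₂ →
      HasType Δ Γ (.lam τ₁ e) (.arr τ₁ τ₂)
  | app {Δ Γ e₁ e₂ τ₂ τ} : HasType Δ Γ e₁ (.arr τ₂ τ) → HasType Δ Γ e₂ τ₂ →
      HasType Δ Γ (.app e₁ e₂) τ
  | tlam {Δ Γ e τ} : HasType (Δ + 1) (Γ.map Ty.shift) e τ → HasType Δ Γ (.tlam e) (.all τ)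
  | tapp {Δ Γ e τ τ₁} : HasType Δ Γ e (.all τ) → τ₁.WF Δ →
      HasType Δ Γ (.tapp e τ₁) (τ.inst τ₁)
  | pack {Δ Γ e τ₁ τ} : τ₁.WF Δ → HasType Δ Γ e (τ.inst τ₁) →
      HasType Δ Γ (.pack τ₁ e τ) (.ex τ)
  | unpack {Δ Γ e₁ e₂ τ₁ τ} : HasType Δ Γ e₁ (.ex τ₁) → τ.WF Δ →
      HasType (Δ + 1) (τ₁ :: Γ.map Ty.shift) e₂ τ.shift → HasType Δ Γ (.unpack e₁ e₂) τ
  | fold {Δ Γ e τ} : HasType Δ Γ e (τ.inst (.mu τ)) → (Ty.mu τ).WF Δ →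
      HasType Δ Γ (.fold (.mu τ) e) (.mu τ)
  | unfold {Δ Γ e τ} : HasType Δ Γ e (.mu τ) → HasType Δ Γ (.unfold e) (τ.inst (.mu τ))

/-- The inclusion `Γ ⊆ Γ'` of typing contexts: the renamings `ξ` (type variables) and `ζ` (term
variables) send distinct variables of the first context to distinct variables of the second one,
respecting types. -/
structure CtxIncl (Δ : ℕ) (Γ : List Ty) (Δ' : ℕ) (Γ' : List Ty) (ξ ζ : ℕ → ℕ) : Prop where
  tyLt : ∀ i, i < Δ → ξ i < Δ'
  tyInj : Set.InjOn ξ {i | i < Δ}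
  tmInj : Set.InjOn ζ {x | x < Γ.length}
  lookup : ∀ x τ, Γ[x]? = some τ → Γ'[ζ x]? = some (τ.rename ξ)

/-- Program contexts: terms with a single hole, anywhere in the term. The hole carries the
renamings that say which variables in scope at the hole are the free variables of the terms put
into it; so the binders above the hole may capture these variables. -/
inductive Ctx (S : PrimSig) : Type where
  | hole (ξ ζ : ℕ → ℕ)
  /-- `o(e₁, …, eᵢ₋₁, C, eᵢ₊₁, …, eₙ)`; the component `args i` is not used. -/
  | op (o : PrimOp S) (i : Fin o.arity) (args : Fin o.arity → Tm S) (C : Ctx S)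
  | ite₁ (C : Ctx S) (e₁ e₂ : Tm S)
  | ite₂ (e : Tm S) (C : Ctx S) (e₂ : Tm S)
  | ite₃ (e e₁ : Tm S) (C : Ctx S)
  | pairL (C : Ctx S) (e₂ : Tm S)
  | pairR (e₁ : Tm S) (C : Ctx S)
  | fst (C : Ctx S)
  | snd (C : Ctx S)
  | inl (τ : Ty) (C : Ctx S)
  | inr (τ : Ty) (C : Ctx S)
  | case₁ (C : Ctx S) (e₁ e₂ : Tm S)
  | case₂ (e : Tm S) (C : Ctx S) (e₂ : Tm S)
  | case₃ (e e₁ : Tm S) (C : Ctx S)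
  | lam (τ : Ty) (C : Ctx S)
  | appL (C : Ctx S) (e : Tm S)
  | appR (e : Tm S) (C : Ctx S)
  | tlam (C : Ctx S)
  | tapp (C : Ctx S) (τ : Ty)
  | pack (τ₁ : Ty) (C : Ctx S) (τ : Ty)
  | unpack₁ (C : Ctx S) (e₂ : Tm S)
  | unpack₂ (e₁ : Tm S) (C : Ctx S)
  | fold (τ : Ty) (C : Ctx S)
  | unfold (C : Ctx S)

/-- `C[e]` -/
def Ctx.fill : Ctx S → Tm S → Tm S
  | hole ξ ζ, e => e.rename ξ ζ
  | op o i args C, e => .op o (Function.update args i (C.fill e))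
  | ite₁ C e₁ e₂, e => .ite (C.fill e) e₁ e₂
  | ite₂ e₀ C e₂, e => .ite e₀ (C.fill e) e₂
  | ite₃ e₀ e₁ C, e => .ite e₀ e₁ (C.fill e)
  | pairL C e₂, e => .pair (C.fill e) e₂
  | pairR e₁ C, e => .pair e₁ (C.fill e)
  | fst C, e => .fst (C.fill e)
  | snd C, e => .snd (C.fill e)
  | inl τ C, e => .inl τ (C.fill e)
  | inr τ C, e => .inr τ (C.fill e)
  | case₁ C e₁ e₂, e => .case (C.fill e) e₁ e₂
  | case₂ e₀ C e₂, e => .case e₀ (C.fill e) e₂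
  | case₃ e₀ e₁ C, e => .case e₀ e₁ (C.fill e)
  | lam τ C, e => .lam τ (C.fill e)
  | appL C e₂, e => .app (C.fill e) e₂
  | appR e₁ C, e => .app e₁ (C.fill e)
  | tlam C, e => .tlam (C.fill e)
  | tapp C τ, e => .tapp (C.fill e) τ
  | pack τ₁ C τ, e => .pack τ₁ (C.fill e) τ
  | unpack₁ C e₂, e => .unpack (C.fill e) e₂
  | unpack₂ e₁ C, e => .unpack e₁ (C.fill e)
  | fold τ C, e => .fold τ (C.fill e)
  | unfold C, e => .unfold (C.fill e)

/-- `CtxHasType Δ₀ Γ₀ τ₀ C Δ Γ τ` is `⊢ C : (Δ₀; Γ₀ ⊢ τ₀) ⇝ (Δ; Γ ⊢ τ)`: the hole has type `τ₀` in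
the typing context `Δ₀; Γ₀`, and the whole has type `τ` in `Δ; Γ`. -/
inductive CtxHasType (Δ₀ : ℕ) (Γ₀ : List Ty) (τ₀ : Ty) : Ctx S → ℕ → List Ty → Ty → Prop
  | hole {Δ Γ ξ ζ} : CtxIncl Δ₀ Γ₀ Δ Γ ξ ζ →
      CtxHasType Δ₀ Γ₀ τ₀ (.hole ξ ζ) Δ Γ (τ₀.rename ξ)
  | op {Δ Γ C} {o : PrimOp S} {i : Fin o.arity} {args : Fin o.arity → Tm S} :
      (∀ j, j ≠ i → HasType Δ Γ (args j) (o.argTy j).toTy) →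
      CtxHasType Δ₀ Γ₀ τ₀ C Δ Γ (o.argTy i).toTy →
      CtxHasType Δ₀ Γ₀ τ₀ (.op o i args C) Δ Γ o.resTy.toTy
  | ite₁ {Δ Γ C e₁ e₂ τ} : CtxHasType Δ₀ Γ₀ τ₀ C Δ Γ .bool → HasType Δ Γ e₁ τ →
      HasType Δ Γ e₂ τ → CtxHasType Δ₀ Γ₀ τ₀ (.ite₁ C e₁ e₂) Δ Γ τ
  | ite₂ {Δ Γ e C e₂ τ} : HasType Δ Γ e .bool → CtxHasType Δ₀ Γ₀ τ₀ C Δ Γ τ →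
      HasType Δ Γ e₂ τ → CtxHasType Δ₀ Γ₀ τ₀ (.ite₂ e C e₂) Δ Γ τ
  | ite₃ {Δ Γ e e₁ C τ} : HasType Δ Γ e .bool → HasType Δ Γ e₁ τ →
      CtxHasType Δ₀ Γ₀ τ₀ C Δ Γ τ → CtxHasType Δ₀ Γ₀ τ₀ (.ite₃ e e₁ C) Δ Γ τ
  | pairL {Δ Γ C e₂ τ₁ τ₂} : CtxHasType Δ₀ Γ₀ τ₀ C Δ Γ τ₁ → HasType Δ Γ e₂ τ₂ →
      CtxHasType Δ₀ Γ₀ τ₀ (.pairL C e₂) Δ Γ (.prod τ₁ τ₂)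
  | pairR {Δ Γ e₁ C τ₁ τ₂} : HasType Δ Γ e₁ τ₁ → CtxHasType Δ₀ Γ₀ τ₀ C Δ Γ τ₂ →
      CtxHasType Δ₀ Γ₀ τ₀ (.pairR e₁ C) Δ Γ (.prod τ₁ τ₂)
  | fst {Δ Γ C τ₁ τ₂} : CtxHasType Δ₀ Γ₀ τ₀ C Δ Γ (.prod τ₁ τ₂) →
      CtxHasType Δ₀ Γ₀ τ₀ (.fst C) Δ Γ τ₁
  | snd {Δ Γ C τ₁ τ₂} : CtxHasType Δ₀ Γ₀ τ₀ C Δ Γ (.prod τ₁ τ₂) →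
      CtxHasType Δ₀ Γ₀ τ₀ (.snd C) Δ Γ τ₂
  | inl {Δ Γ C τ₁ τ₂} : τ₂.WF Δ → CtxHasType Δ₀ Γ₀ τ₀ C Δ Γ τ₁ →
      CtxHasType Δ₀ Γ₀ τ₀ (.inl (.sum τ₁ τ₂) C) Δ Γ (.sum τ₁ τ₂)
  | inr {Δ Γ C τ₁ τ₂} : τ₁.WF Δ → CtxHasType Δ₀ Γ₀ τ₀ C Δ Γ τ₂ →
      CtxHasType Δ₀ Γ₀ τ₀ (.inr (.sum τ₁ τ₂) C) Δ Γ (.sum τ₁ τ₂)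
  | case₁ {Δ Γ C e₁ e₂ τ₁ τ₂ τ} : CtxHasType Δ₀ Γ₀ τ₀ C Δ Γ (.sum τ₁ τ₂) →
      HasType Δ (τ₁ :: Γ) e₁ τ → HasType Δ (τ₂ :: Γ) e₂ τ →
      CtxHasType Δ₀ Γ₀ τ₀ (.case₁ C e₁ e₂) Δ Γ τ
  | case₂ {Δ Γ e C e₂ τ₁ τ₂ τ} : HasType Δ Γ e (.sum τ₁ τ₂) →
      CtxHasType Δ₀ Γ₀ τ₀ C Δ (τ₁ :: Γ) τ → HasType Δ (τ₂ :: Γ) e₂ τ →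
      CtxHasType Δ₀ Γ₀ τ₀ (.case₂ e C e₂) Δ Γ τ
  | case₃ {Δ Γ e e₁ C τ₁ τ₂ τ} : HasType Δ Γ e (.sum τ₁ τ₂) →
      HasType Δ (τ₁ :: Γ) e₁ τ → CtxHasType Δ₀ Γ₀ τ₀ C Δ (τ₂ :: Γ) τ →
      CtxHasType Δ₀ Γ₀ τ₀ (.case₃ e e₁ C) Δ Γ τ
  | lam {Δ Γ C τ₁ τ₂} : τ₁.WF Δ → CtxHasType Δ₀ Γ₀ τ₀ C Δ (τ₁ :: Γ) τ₂ →
      CtxHasType Δ₀ Γ₀ τ₀ (.lam τ₁ C) Δ Γ (.arr τ₁ τ₂)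
  | appL {Δ Γ C e₂ τ₂ τ} : CtxHasType Δ₀ Γ₀ τ₀ C Δ Γ (.arr τ₂ τ) → HasType Δ Γ e₂ τ₂ →
      CtxHasType Δ₀ Γ₀ τ₀ (.appL C e₂) Δ Γ τ
  | appR {Δ Γ e₁ C τ₂ τ} : HasType Δ Γ e₁ (.arr τ₂ τ) → CtxHasType Δ₀ Γ₀ τ₀ C Δ Γ τ₂ →
      CtxHasType Δ₀ Γ₀ τ₀ (.appR e₁ C) Δ Γ τ
  | tlam {Δ Γ C τ} : CtxHasType Δ₀ Γ₀ τ₀ C (Δ + 1) (Γ.map Ty.shift) τ →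
      CtxHasType Δ₀ Γ₀ τ₀ (.tlam C) Δ Γ (.all τ)
  | tapp {Δ Γ C τ τ₁} : CtxHasType Δ₀ Γ₀ τ₀ C Δ Γ (.all τ) → τ₁.WF Δ →
      CtxHasType Δ₀ Γ₀ τ₀ (.tapp C τ₁) Δ Γ (τ.inst τ₁)
  | pack {Δ Γ C τ₁ τ} : τ₁.WF Δ → CtxHasType Δ₀ Γ₀ τ₀ C Δ Γ (τ.inst τ₁) →
      CtxHasType Δ₀ Γ₀ τ₀ (.pack τ₁ C τ) Δ Γ (.ex τ)
  | unpack₁ {Δ Γ C e₂ τ₁ τ} : CtxHasType Δ₀ Γ₀ τ₀ C Δ Γ (.ex τ₁) → τ.WF Δ →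
      HasType (Δ + 1) (τ₁ :: Γ.map Ty.shift) e₂ τ.shift →
      CtxHasType Δ₀ Γ₀ τ₀ (.unpack₁ C e₂) Δ Γ τ
  | unpack₂ {Δ Γ e₁ C τ₁ τ} : HasType Δ Γ e₁ (.ex τ₁) → τ.WF Δ →
      CtxHasType Δ₀ Γ₀ τ₀ C (Δ + 1) (τ₁ :: Γ.map Ty.shift) τ.shift →
      CtxHasType Δ₀ Γ₀ τ₀ (.unpack₂ e₁ C) Δ Γ τ
  | fold {Δ Γ C τ} : CtxHasType Δ₀ Γ₀ τ₀ C Δ Γ (τ.inst (.mu τ)) → (Ty.mu τ).WF Δ →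
      CtxHasType Δ₀ Γ₀ τ₀ (.fold (.mu τ) C) Δ Γ (.mu τ)
  | unfold {Δ Γ C τ} : CtxHasType Δ₀ Γ₀ τ₀ C Δ Γ (.mu τ) →
      CtxHasType Δ₀ Γ₀ τ₀ (.unfold C) Δ Γ (τ.inst (.mu τ))

/-- Contextual approximation `Δ; Γ ⊢ e₁ ≼ e₂ : τ`: both terms have type `τ`, and every closed
program context that terminates around `e₁` terminates around `e₂`. -/
def CtxApprox (Δ : ℕ) (Γ : List Ty) (e₁ e₂ : Tm S) (τ : Ty) : Prop :=
  HasType Δ Γ e₁ τ ∧ HasType Δ Γ e₂ τ ∧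
    ∀ (C : Ctx S) (τ' : Ty), CtxHasType Δ Γ τ C 0 [] τ' →
      Terminates (C.fill e₁) → Terminates (C.fill e₂)

/-- The function `f` with domain `τ` is total: `f x` evaluates to a value for every closed value
`x` of type `τ`. -/
def Total (f : Tm S) (τ : Ty) : Prop :=
  ∀ x : Tm S, HasType 0 [] x τ → IsValue x → ∃ y, EvalsTo (.app f x) y

end Statics

/-- `∀α. α → α → α` -/
def choiceTy : Ty := .all (.arr (.var 0) (.arr (.var 0) (.var 0)))

end FMu

/-!
The proof is by parametricity, through a step-indexed logical relation. The relation `ValRel τ ρ`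
between values is defined by recursion on the type `τ`, where `ρ` interprets the free type
variables by arbitrary step-indexed relations on values. A recursive type is interpreted by a
fixed point that exists because unrolling consumes a step: relatedness of folded values at index
`k` refers to their contents only at indices below `k`. Accordingly it is enough to count the
contractions of `unfold (fold v)`, and evaluation is handled in the big-step form `Eval`, which
`terminates_iff_eval` identifies with termination of the small-step reduction. The related values
need not be typed or closed, so subject reduction plays no part.

Every term constructor preserves the relation (the lemmas in the namespace `LogRel`). Hence
well-typed terms are related to themselves (`HasType.logRel`), program contexts preserve
relatedness (`CtxHasType.logRel`), and logical approximation implies contextual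
approximation (`LogRel.ctxApprox`).

For the two inequalities, let `f v` and `f w` evaluate to `v'` and `w'`. The type variable of
`∀α. α → α → α` is interpreted by the relation that contains just the pairs `(v', v)` and
`(w', w)` (`ExpRel.choice`), so `h[σ] v' w'` and `h[τ] v w` make the same choice; applying `f` to
the result of the latter gives the result of the former. Conversely the pairs are reversed. That
`f v` and `f w` evaluate at all is part of the hypothesis in the first case (the left-hand side
terminates only if both do); in the second case it is what totality of `f` provides.
-/

namespace FMu

/-! ### The algebra of simultaneous substitutions -/

theorem scons_comp_upRen {A : Type} (a : A) (g : ℕ → A) (ξ : ℕ → ℕ) :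
    (fun i => scons a g (upRen ξ i)) = scons a fun i => g (ξ i) := by
  funext i; cases i <;> rfl

theorem upRen_comp (ξ ξ' : ℕ → ℕ) :
    (fun i => upRen ξ' (upRen ξ i)) = upRen fun i => ξ' (ξ i) := by
  funext i; cases i <;> rfl

theorem upRen_id : upRen (fun i => i) = fun i => i := by
  funext i; cases i <;> rfl

namespace Ty

theorem rename_rename (τ : Ty) : ∀ ξ ξ' : ℕ → ℕ,
    (τ.rename ξ).rename ξ' = τ.rename fun i => ξ' (ξ i) := by
  induction τ <;> intro ξ ξ' <;> simp_all [rename, upRen_comp]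

theorem rename_id (τ : Ty) : τ.rename id = τ := by
  change τ.rename (fun i => i) = τ
  induction τ <;> simp_all [rename, upRen_id]

theorem up_comp_upRen (θ : ℕ → Ty) (ξ : ℕ → ℕ) :
    (fun i => up θ (upRen ξ i)) = up fun i => θ (ξ i) :=
  scons_comp_upRen _ _ _

theorem subst_rename (τ : Ty) : ∀ (ξ : ℕ → ℕ) (θ : ℕ → Ty),
    (τ.rename ξ).subst θ = τ.subst fun i => θ (ξ i) := by
  induction τ <;> intro ξ θ <;> simp_all [rename, subst, up_comp_upRen]

theorem up_rename (θ : ℕ → Ty) (ξ : ℕ → ℕ) :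
    (fun i => (up θ i).rename (upRen ξ)) = up fun i => (θ i).rename ξ := by
  funext i
  cases i
  · rfl
  · simp [up, scons, shift, rename_rename, upRen]

theorem rename_subst (τ : Ty) : ∀ (θ : ℕ → Ty) (ξ : ℕ → ℕ),
    (τ.subst θ).rename ξ = τ.subst fun i => (θ i).rename ξ := by
  induction τ <;> intro θ ξ <;> simp_all [rename, subst, up_rename]

theorem up_subst (θ θ' : ℕ → Ty) :
    (fun i => (up θ i).subst (up θ')) = up fun i => (θ i).subst θ' := by
  funext i
  cases i
  · rfl
  · simp [up, scons, shift, subst_rename, rename_subst]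

theorem subst_subst (τ : Ty) : ∀ θ θ' : ℕ → Ty,
    (τ.subst θ).subst θ' = τ.subst fun i => (θ i).subst θ' := by
  induction τ <;> intro θ θ' <;> simp_all [subst, up_subst]

theorem up_var : up var = var := by
  funext i; cases i <;> rfl

theorem subst_var (τ : Ty) : τ.subst var = τ := by
  induction τ <;> simp_all [subst, up_var]

theorem up_subst_scons (θ : ℕ → Ty) (τ : Ty) :
    (fun i => (up θ i).subst (scons τ var)) = scons τ θ := by
  funext i
  cases i
  · rfl
  · simp [up, scons, shift, subst_rename, subst_var]

end Ty

namespace Tm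

variable {S : PrimSig}

theorem rename_rename (e : Tm S) : ∀ ξ ξ' ζ ζ' : ℕ → ℕ,
    (e.rename ξ ζ).rename ξ' ζ' = e.rename (fun i => ξ' (ξ i)) fun x => ζ' (ζ x) := by
  induction e <;> intro ξ ξ' ζ ζ' <;> simp_all [rename, Ty.rename_rename, upRen_comp]

theorem up_comp_upRen (γ : ℕ → Tm S) (ζ : ℕ → ℕ) :
    (fun x => up γ (upRen ζ x)) = up fun x => γ (ζ x) :=
  scons_comp_upRen _ _ _

theorem tup_comp (γ : ℕ → Tm S) (ζ : ℕ → ℕ) :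
    (fun x => tup γ (ζ x)) = tup fun x => γ (ζ x) := rfl

theorem subst_rename (e : Tm S) : ∀ (ξ ζ : ℕ → ℕ) (θ : ℕ → Ty) (γ : ℕ → Tm S),
    (e.rename ξ ζ).subst θ γ = e.subst (fun i => θ (ξ i)) fun x => γ (ζ x) := by
  induction e <;> intro ξ ζ θ γ <;>
    simp_all [rename, subst, Ty.subst_rename, up_comp_upRen, Ty.up_comp_upRen, tup_comp]

theorem up_rename (γ : ℕ → Tm S) (ξ ζ : ℕ → ℕ) :
    (fun x => (up γ x).rename ξ (upRen ζ)) = up fun x => (γ x).rename ξ ζ := by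
  funext x
  cases x
  · rfl
  · simp [up, scons, rename_rename, upRen]

theorem tup_rename (γ : ℕ → Tm S) (ξ ζ : ℕ → ℕ) :
    (fun x => (tup γ x).rename (upRen ξ) ζ) = tup fun x => (γ x).rename ξ ζ := by
  funext x
  simp [tup, rename_rename, upRen, scons]

theorem rename_subst (e : Tm S) : ∀ (θ : ℕ → Ty) (γ : ℕ → Tm S) (ξ ζ : ℕ → ℕ),
    (e.subst θ γ).rename ξ ζ =
      e.subst (fun i => (θ i).rename ξ) fun x => (γ x).rename ξ ζ := by
  induction e <;> intro θ γ ξ ζ <;>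
    simp_all [rename, subst, Ty.rename_subst, up_rename, Ty.up_rename, tup_rename]

theorem up_subst (γ γ' : ℕ → Tm S) (θ' : ℕ → Ty) :
    (fun x => (up γ x).subst θ' (up γ')) = up fun x => (γ x).subst θ' γ' := by
  funext x
  cases x
  · rfl
  · simp only [up, scons, subst_rename, rename_subst, id, Ty.rename_id]

theorem tup_subst (γ γ' : ℕ → Tm S) (θ' : ℕ → Ty) :
    (fun x => (tup γ x).subst (Ty.up θ') (tup γ')) = tup fun x => (γ x).subst θ' γ' := by
  funext x
  simp [tup, subst_rename, rename_subst, Ty.up, scons]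
  rfl

theorem subst_subst (e : Tm S) : ∀ (θ θ' : ℕ → Ty) (γ γ' : ℕ → Tm S),
    (e.subst θ γ).subst θ' γ' =
      e.subst (fun i => (θ i).subst θ') fun x => (γ x).subst θ' γ' := by
  induction e <;> intro θ θ' γ γ' <;>
    simp_all [subst, Ty.subst_subst, up_subst, Ty.up_subst, tup_subst]

theorem up_var : up (var : ℕ → Tm S) = var := by
  funext i; cases i <;> rfl

theorem tup_var : tup (var : ℕ → Tm S) = var := rfl

theorem subst_var (e : Tm S) : e.subst Ty.var var = e := by
  induction e <;> simp_all [subst, Ty.subst_var, up_var, Ty.up_var, tup_var]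

theorem inst_subst (e v : Tm S) (θ : ℕ → Ty) (γ : ℕ → Tm S) :
    (e.subst θ (up γ)).inst v = e.subst θ (scons v γ) := by
  rw [inst, subst_subst]
  congr 1
  · exact funext fun i => Ty.subst_var _
  · funext x
    cases x
    · rfl
    · simp only [up, scons, subst_rename, id]
      exact subst_var _

theorem tinst_subst (e : Tm S) (τ : Ty) (θ : ℕ → Ty) (γ : ℕ → Tm S) :
    (e.subst (Ty.up θ) (tup γ)).tinst τ = e.subst (scons τ θ) γ := by
  rw [tinst, subst_subst, Ty.up_subst_scons]
  congr 1
  funext x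
  simp only [tup, scons, subst_rename, id]
  exact subst_var _

theorem unpackInst_subst (e v : Tm S) (τ : Ty) (θ : ℕ → Ty) (γ : ℕ → Tm S) :
    (e.subst (Ty.up θ) (up (tup γ))).unpackInst τ v = e.subst (scons τ θ) (scons v γ) := by
  rw [unpackInst, subst_subst, Ty.up_subst_scons]
  congr 1
  funext x
  cases x
  · rfl
  · simp only [up, tup, scons, subst_rename, id]
    exact subst_var _

end Tm

/-! ### Values and counted evaluation -/

section Evaluation

variable {S : PrimSig}

theorem IsValue.subst {v : Tm S} (hv : IsValue v) {θ : ℕ → Ty} {γ : ℕ → Tm S}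
    (hγ : ∀ x, IsValue (γ x)) : IsValue (v.subst θ γ) := by
  induction hv with
  | var x => exact hγ x
  | _ => constructor <;> assumption

theorem Base.isValue_toTm (b : Base) (a : b.Val) : IsValue (b.toTm a : Tm S) := by
  cases b with
  | unit => exact .unit
  | int => exact .int _
  | bool => cases a <;> constructor

theorem Base.toTm_injective (b : Base) : Function.Injective (b.toTm : b.Val → Tm S) := by
  intro a a' h
  cases b with
  | unit => rfl
  | int => exact Tm.int.inj h
  | bool => cases a <;> cases a' <;> first | rfl | cases h

/-- Big-step evaluation `e ⇓ v`; the number `n` counts the contractions `unfold (fold v) ⇝ v`,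
the only reductions that the step-indexed interpretation of recursive types has to pay for. -/
inductive Eval : Tm S → ℕ → Tm S → Prop
  | var (x : ℕ) : Eval (.var x) 0 (.var x)
  | unit : Eval .unit 0 .unit
  | int (n : ℤ) : Eval (.int n) 0 (.int n)
  | op {o : PrimOp S} {args : Fin o.arity → Tm S} (n : Fin o.arity → ℕ)
      (a : (i : Fin o.arity) → (o.argTy i).Val) :
      (∀ i, Eval (args i) (n i) ((o.argTy i).toTm (a i))) →
      Eval (.op o args) (∑ i, n i) (o.resTy.toTm (o.interp a))
  | tru : Eval .tru 0 .tru
  | fls : Eval .fls 0 .fls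
  | iteTrue {e e₁ e₂ v : Tm S} {n m : ℕ} : Eval e n .tru → Eval e₁ m v →
      Eval (.ite e e₁ e₂) (n + m) v
  | iteFalse {e e₁ e₂ v : Tm S} {n m : ℕ} : Eval e n .fls → Eval e₂ m v →
      Eval (.ite e e₁ e₂) (n + m) v
  | pair {e₁ e₂ v₁ v₂ : Tm S} {n m : ℕ} : Eval e₁ n v₁ → Eval e₂ m v₂ →
      Eval (.pair e₁ e₂) (n + m) (.pair v₁ v₂)
  | fst {e v₁ v₂ : Tm S} {n : ℕ} : Eval e n (.pair v₁ v₂) → Eval (.fst e) n v₁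
  | snd {e v₁ v₂ : Tm S} {n : ℕ} : Eval e n (.pair v₁ v₂) → Eval (.snd e) n v₂
  | inl {τ : Ty} {e v : Tm S} {n : ℕ} : Eval e n v → Eval (.inl τ e) n (.inl τ v)
  | inr {τ : Ty} {e v : Tm S} {n : ℕ} : Eval e n v → Eval (.inr τ e) n (.inr τ v)
  | caseInl {τ : Ty} {e e₁ e₂ u v : Tm S} {n m : ℕ} : Eval e n (.inl τ u) →
      Eval (e₁.inst u) m v → Eval (.case e e₁ e₂) (n + m) v
  | caseInr {τ : Ty} {e e₁ e₂ u v : Tm S} {n m : ℕ} : Eval e n (.inr τ u) →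
      Eval (e₂.inst u) m v → Eval (.case e e₁ e₂) (n + m) v
  | lam (τ : Ty) (e : Tm S) : Eval (.lam τ e) 0 (.lam τ e)
  | app {τ : Ty} {e₁ e₂ e u v : Tm S} {n m l : ℕ} : Eval e₁ n (.lam τ e) → Eval e₂ m u →
      Eval (e.inst u) l v → Eval (.app e₁ e₂) (n + m + l) v
  | tlam (e : Tm S) : Eval (.tlam e) 0 (.tlam e)
  | tapp {τ : Ty} {e e' v : Tm S} {n m : ℕ} : Eval e n (.tlam e') → Eval (e'.tinst τ) m v →
      Eval (.tapp e τ) (n + m) v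
  | pack {τ₁ τ : Ty} {e v : Tm S} {n : ℕ} : Eval e n v →
      Eval (.pack τ₁ e τ) n (.pack τ₁ v τ)
  | unpack {τ₁ τ : Ty} {e e' u v : Tm S} {n m : ℕ} : Eval e n (.pack τ₁ u τ) →
      Eval (e'.unpackInst τ₁ u) m v → Eval (.unpack e e') (n + m) v
  | fold {τ : Ty} {e v : Tm S} {n : ℕ} : Eval e n v → Eval (.fold τ e) n (.fold τ v)
  | unfold {τ : Ty} {e v : Tm S} {n : ℕ} : Eval e n (.fold τ v) → Eval (.unfold e) (n + 1) v

theorem Eval.isValue {e v : Tm S} {n : ℕ} (h : Eval e n v) : IsValue v := by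
  induction h with
  | op => exact Base.isValue_toTm _ _
  | fst _ ih => cases ih; assumption
  | snd _ ih => cases ih; assumption
  | unfold _ ih => cases ih; assumption
  | _ => first | assumption | (constructor <;> assumption)

theorem IsValue.eval {v : Tm S} (hv : IsValue v) : Eval v 0 v := by
  induction hv with
  | pair _ _ ih₁ ih₂ => exact .pair ih₁ ih₂
  | _ => constructor <;> assumption

theorem IsValue.eval_inv {v : Tm S} (hv : IsValue v) {n : ℕ} {r : Tm S} (h : Eval v n r) :
    n = 0 ∧ r = v := by
  induction hv generalizing n r with
  | pair _ _ ih₁ ih₂ =>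
    cases h with
    | pair h₁ h₂ =>
      obtain ⟨rfl, rfl⟩ := ih₁ h₁
      obtain ⟨rfl, rfl⟩ := ih₂ h₂
      exact ⟨rfl, rfl⟩
  | inl _ _ ih => cases h with | inl h => obtain ⟨rfl, rfl⟩ := ih h; exact ⟨rfl, rfl⟩
  | inr _ _ ih => cases h with | inr h => obtain ⟨rfl, rfl⟩ := ih h; exact ⟨rfl, rfl⟩
  | pack _ _ _ ih => cases h with | pack h => obtain ⟨rfl, rfl⟩ := ih h; exact ⟨rfl, rfl⟩
  | fold _ _ ih => cases h with | fold h => obtain ⟨rfl, rfl⟩ := ih h; exact ⟨rfl, rfl⟩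
  | _ => cases h; exact ⟨rfl, rfl⟩

theorem Eval.det {e v : Tm S} {n : ℕ} (h : Eval e n v) :
    ∀ {m : ℕ} {w : Tm S}, Eval e m w → w = v := by
  induction h with
  | op n a _ ih =>
    intro m w h'
    cases h' with
    | op n' a' h' =>
      have : a' = a := funext fun i => Base.toTm_injective _ (ih i (h' i))
      rw [this]
  | iteTrue _ _ ih ih' =>
    intro m w h'
    cases h' with
    | iteTrue h h' => exact ih' h'
    | iteFalse h h' => cases ih h
  | iteFalse _ _ ih ih' =>
    intro m w h'
    cases h' with
    | iteTrue h h' => cases ih h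
    | iteFalse h h' => exact ih' h'
  | pair _ _ ih ih' =>
    intro m w h'
    cases h' with | pair h h' => rw [ih h, ih' h']
  | fst _ ih =>
    intro m w h'
    cases h' with | fst h => cases ih h; rfl
  | snd _ ih =>
    intro m w h'
    cases h' with | snd h => cases ih h; rfl
  | inl _ ih =>
    intro m w h'
    cases h' with | inl h => rw [ih h]
  | inr _ ih =>
    intro m w h'
    cases h' with | inr h => rw [ih h]
  | caseInl _ _ ih ih' =>
    intro m w h'
    cases h' with
    | caseInl h h' => cases ih h; exact ih' h'
    | caseInr h h' => cases ih h
  | caseInr _ _ ih ih' =>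
    intro m w h'
    cases h' with
    | caseInl h h' => cases ih h
    | caseInr h h' => cases ih h; exact ih' h'
  | app _ _ _ ih₁ ih₂ ih₃ =>
    intro m w h'
    cases h' with | app h₁ h₂ h₃ => cases ih₁ h₁; cases ih₂ h₂; exact ih₃ h₃
  | tapp _ _ ih ih' =>
    intro m w h'
    cases h' with | tapp h h' => cases ih h; exact ih' h'
  | pack _ ih =>
    intro m w h'
    cases h' with | pack h => rw [ih h]
  | unpack _ _ ih ih' =>
    intro m w h'
    cases h' with | unpack h h' => cases ih h; exact ih' h'
  | fold _ ih =>
    intro m w h'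
    cases h' with | fold h => rw [ih h]
  | unfold _ ih =>
    intro m w h'
    cases h' with | unfold h => cases ih h; rfl
  | _ => intro m w h'; cases h'; rfl

/-- Evaluation of an application only depends on the values of function and argument. -/
theorem Eval.app_of_app {e₁ e₂ g u r : Tm S} {n m l : ℕ} (h₁ : Eval e₁ n g) (h₂ : Eval e₂ m u)
    (h : Eval (.app g u) l r) : ∃ k, Eval (.app e₁ e₂) k r := by
  cases h with
  | app hg hu hb =>
    obtain ⟨-, rfl⟩ := h₁.isValue.eval_inv hg
    obtain ⟨-, rfl⟩ := h₂.isValue.eval_inv hu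
    exact ⟨_, .app h₁ h₂ hb⟩

theorem Eval.tapp_of_tapp {e g r : Tm S} {τ : Ty} {n l : ℕ} (h₁ : Eval e n g)
    (h : Eval (.tapp g τ) l r) : ∃ k, Eval (.tapp e τ) k r := by
  cases h with
  | tapp hg hb =>
    obtain ⟨-, rfl⟩ := h₁.isValue.eval_inv hg
    exact ⟨_, .tapp h₁ hb⟩

/-! ### Agreement of big-step evaluation and small-step reduction -/

theorem HeadStep.eval {e e' : Tm S} (h : HeadStep e e') {n : ℕ} {v : Tm S} (he : Eval e' n v) :
    ∃ m, Eval e m v := by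
  cases h with
  | op o a =>
    obtain ⟨-, rfl⟩ := (Base.isValue_toTm _ _).eval_inv he
    exact ⟨_, .op (fun _ => 0) a fun i => (Base.isValue_toTm _ _).eval⟩
  | iteTrue => exact ⟨_, .iteTrue .tru he⟩
  | iteFalse => exact ⟨_, .iteFalse .fls he⟩
  | fst h₁ h₂ =>
    obtain ⟨-, rfl⟩ := h₁.eval_inv he
    exact ⟨_, .fst (h₁.pair h₂).eval⟩
  | snd h₁ h₂ =>
    obtain ⟨-, rfl⟩ := h₂.eval_inv he
    exact ⟨_, .snd (h₁.pair h₂).eval⟩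
  | caseInl τ _ _ h => exact ⟨_, .caseInl (h.inl τ).eval he⟩
  | caseInr τ _ _ h => exact ⟨_, .caseInr (h.inr τ).eval he⟩
  | beta τ b h => exact ⟨_, .app (.lam τ b) h.eval he⟩
  | tbeta b τ => exact ⟨_, .tapp (.tlam b) he⟩
  | unpack τ τ₁ b h => exact ⟨_, .unpack (h.pack τ τ₁).eval he⟩
  | unfold τ h =>
    obtain ⟨-, rfl⟩ := h.eval_inv he
    exact ⟨_, .unfold (h.fold τ).eval⟩

theorem EvalCtx.eval_fill {e e' : Tm S} (ih : ∀ n v, Eval e' n v → ∃ m, Eval e m v)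
    (E : EvalCtx S) : ∀ n v, Eval (E.fill e') n v → ∃ m, Eval (E.fill e) m v := by
  induction E with
  | hole => exact ih
  | op o i args hv E ihE =>
    intro n v h
    cases h with
    | op n a h =>
      have hi := h i
      rw [Function.update_self] at hi
      obtain ⟨m, hm⟩ := ihE _ _ hi
      refine ⟨_, .op (Function.update n i m) a fun j => ?_⟩
      by_cases hj : j = i
      · subst hj
        simpa using hm
      · simpa [hj] using h j
  | ite E e₁ e₂ ihE =>
    intro n v h
    cases h with
    | iteTrue h h' => obtain ⟨m, hm⟩ := ihE _ _ h; exact ⟨_, .iteTrue hm h'⟩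
    | iteFalse h h' => obtain ⟨m, hm⟩ := ihE _ _ h; exact ⟨_, .iteFalse hm h'⟩
  | pairL E e₂ ihE =>
    intro n v h
    cases h with | pair h h' => obtain ⟨m, hm⟩ := ihE _ _ h; exact ⟨_, .pair hm h'⟩
  | pairR v₁ hv E ihE =>
    intro n v h
    cases h with | pair h h' => obtain ⟨m, hm⟩ := ihE _ _ h'; exact ⟨_, .pair h hm⟩
  | fst E ihE =>
    intro n v h
    cases h with | fst h => obtain ⟨m, hm⟩ := ihE _ _ h; exact ⟨_, .fst hm⟩
  | snd E ihE =>
    intro n v h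
    cases h with | snd h => obtain ⟨m, hm⟩ := ihE _ _ h; exact ⟨_, .snd hm⟩
  | inl τ E ihE =>
    intro n v h
    cases h with | inl h => obtain ⟨m, hm⟩ := ihE _ _ h; exact ⟨_, .inl hm⟩
  | inr τ E ihE =>
    intro n v h
    cases h with | inr h => obtain ⟨m, hm⟩ := ihE _ _ h; exact ⟨_, .inr hm⟩
  | case E e₁ e₂ ihE =>
    intro n v h
    cases h with
    | caseInl h h' => obtain ⟨m, hm⟩ := ihE _ _ h; exact ⟨_, .caseInl hm h'⟩
    | caseInr h h' => obtain ⟨m, hm⟩ := ihE _ _ h; exact ⟨_, .caseInr hm h'⟩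
  | appL E e₂ ihE =>
    intro n v h
    cases h with | app h h' h'' => obtain ⟨m, hm⟩ := ihE _ _ h; exact ⟨_, .app hm h' h''⟩
  | appR v₁ hv E ihE =>
    intro n v h
    cases h with | app h h' h'' => obtain ⟨m, hm⟩ := ihE _ _ h'; exact ⟨_, .app h hm h''⟩
  | tapp E τ ihE =>
    intro n v h
    cases h with | tapp h h' => obtain ⟨m, hm⟩ := ihE _ _ h; exact ⟨_, .tapp hm h'⟩
  | pack τ₁ E τ ihE =>
    intro n v h
    cases h with | pack h => obtain ⟨m, hm⟩ := ihE _ _ h; exact ⟨_, .pack hm⟩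
  | unpack E e₂ ihE =>
    intro n v h
    cases h with | unpack h h' => obtain ⟨m, hm⟩ := ihE _ _ h; exact ⟨_, .unpack hm h'⟩
  | fold τ E ihE =>
    intro n v h
    cases h with | fold h => obtain ⟨m, hm⟩ := ihE _ _ h; exact ⟨_, .fold hm⟩
  | unfold E ihE =>
    intro n v h
    cases h with | unfold h => obtain ⟨m, hm⟩ := ihE _ _ h; exact ⟨_, .unfold hm⟩

theorem Step.eval {e e' : Tm S} (h : Step e e') : ∀ n v, Eval e' n v → ∃ m, Eval e m v := by
  induction h with
  | head h => exact fun n v => h.eval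
  | ctx E _ ih => exact E.eval_fill ih

theorem EvalsTo.eval {e v : Tm S} (h : EvalsTo e v) : ∃ n, Eval e n v := by
  obtain ⟨h, hv⟩ := h
  induction h using Relation.ReflTransGen.head_induction_on with
  | refl => exact ⟨0, hv.eval⟩
  | head h _ ih =>
    obtain ⟨n, hn⟩ := ih
    exact h.eval n v hn

theorem EvalCtx.steps_fill (E : EvalCtx S) {e e' : Tm S} (h : Relation.ReflTransGen Step e e') :
    Relation.ReflTransGen Step (E.fill e) (E.fill e') :=
  h.lift _ fun _ _ h => .ctx E h

theorem steps_op (o : PrimOp S) {args vals : Fin o.arity → Tm S} (hv : ∀ i, IsValue (vals i))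
    (h : ∀ i, Relation.ReflTransGen Step (args i) (vals i)) :
    Relation.ReflTransGen Step (.op o args) (.op o vals) := by
  -- Left-to-right evaluation: after `m` arguments, exactly those with index below `m` are replaced.
  have key : ∀ m ≤ o.arity, Relation.ReflTransGen Step (.op o args)
      (.op o fun i => if i.val < m then vals i else args i) := by
    intro m
    induction m with
    | zero => intro _; simpa using Relation.ReflTransGen.refl
    | succ m ih =>
      intro hm
      refine (ih (by omega)).trans ?_
      let i : Fin o.arity := ⟨m, hm⟩
      have step := (EvalCtx.op o i (fun j => if j.val < m then vals j else args j)
        (fun j hj => by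
          have : j.val < m := hj
          simpa [this] using hv j) .hole).steps_fill (h i)
      simp only [EvalCtx.fill] at step
      convert step using 2
      · funext j
        by_cases hj : j = i
        · subst hj; simp [i]
        · simp [hj]
      · funext j
        by_cases hj : j = i
        · subst hj; simp [i]
        · have : j.val ≠ m := fun h => hj (Fin.ext h)
          have : j.val < m + 1 ↔ j.val < m := by omega
          simp [hj, this]
  simpa using key _ le_rfl

theorem Eval.steps {e v : Tm S} {n : ℕ} (h : Eval e n v) : Relation.ReflTransGen Step e v := by
  induction h with
  | op n a _ ih =>
    exact (steps_op _ (fun _ => Base.isValue_toTm _ _) ih).tail (.head (.op _ a))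
  | @iteTrue _ e₁ e₂ _ _ _ _ _ ih ih' =>
    exact (((EvalCtx.ite .hole e₁ e₂).steps_fill ih).tail (.head (.iteTrue _ _))).trans ih'
  | @iteFalse _ e₁ e₂ _ _ _ _ _ ih ih' =>
    exact (((EvalCtx.ite .hole e₁ e₂).steps_fill ih).tail (.head (.iteFalse _ _))).trans ih'
  | @pair _ e₂ _ _ _ _ h _ ih ih' =>
    exact ((EvalCtx.pairL .hole e₂).steps_fill ih).trans
      ((EvalCtx.pairR _ h.isValue .hole).steps_fill ih')
  | fst h ih =>
    cases h.isValue with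
    | pair h₁ h₂ => exact ((EvalCtx.fst .hole).steps_fill ih).tail (.head (.fst h₁ h₂))
  | snd h ih =>
    cases h.isValue with
    | pair h₁ h₂ => exact ((EvalCtx.snd .hole).steps_fill ih).tail (.head (.snd h₁ h₂))
  | @inl τ _ _ _ _ ih => exact (EvalCtx.inl τ .hole).steps_fill ih
  | @inr τ _ _ _ _ ih => exact (EvalCtx.inr τ .hole).steps_fill ih
  | @caseInl τ _ e₁ e₂ _ _ _ _ h _ ih ih' =>
    cases h.isValue with
    | inl _ hu =>
      exact (((EvalCtx.case .hole e₁ e₂).steps_fill ih).tail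
        (.head (.caseInl τ e₁ e₂ hu))).trans ih'
  | @caseInr τ _ e₁ e₂ _ _ _ _ h _ ih ih' =>
    cases h.isValue with
    | inr _ hu =>
      exact (((EvalCtx.case .hole e₁ e₂).steps_fill ih).tail
        (.head (.caseInr τ e₁ e₂ hu))).trans ih'
  | @app τ _ e₂ e _ _ _ _ _ h h' _ ih₁ ih₂ ih₃ =>
    exact (((EvalCtx.appL .hole e₂).steps_fill ih₁).trans
      (((EvalCtx.appR _ h.isValue .hole).steps_fill ih₂).tail
        (.head (.beta τ e h'.isValue)))).trans ih₃
  | @tapp τ _ e' _ _ _ _ _ ih ih' =>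
    exact (((EvalCtx.tapp .hole τ).steps_fill ih).tail (.head (.tbeta e' τ))).trans ih'
  | @pack τ₁ τ _ _ _ _ ih => exact (EvalCtx.pack τ₁ .hole τ).steps_fill ih
  | @unpack τ₁ τ _ e' _ _ _ _ h _ ih ih' =>
    cases h.isValue with
    | pack _ _ hu =>
      exact (((EvalCtx.unpack .hole e').steps_fill ih).tail
        (.head (.unpack τ₁ τ e' hu))).trans ih'
  | @fold τ _ _ _ _ ih => exact (EvalCtx.fold τ .hole).steps_fill ih
  | @unfold τ _ _ _ h ih =>
    cases h.isValue with
    | fold _ hv => exact ((EvalCtx.unfold .hole).steps_fill ih).tail (.head (.unfold τ hv))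
  | _ => exact .refl

theorem terminates_iff_eval {e : Tm S} : Terminates e ↔ ∃ n v, Eval e n v := by
  constructor
  · rintro ⟨v, h⟩
    obtain ⟨n, hn⟩ := h.eval
    exact ⟨n, v, hn⟩
  · rintro ⟨n, v, h⟩
    exact ⟨v, h.steps, h.isValue⟩

end Evaluation

/-! ### Step-indexed relations and guarded fixed points -/

section Relations

variable {S : PrimSig}

/-- A step-indexed relation between terms: `R k v₁ v₂` says that `v₁` and `v₂` are related as far
as this can be observed within `k` steps. -/
abbrev SemTy (S : PrimSig) : Type := ℕ → Tm S → Tm S → Prop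

/-- The relations that interpret types: they relate values only, and are closed under decreasing
the step index. No typing requirement is imposed on the related values. -/
structure SemTy.Good (R : SemTy S) : Prop where
  left : ∀ {k v₁ v₂}, R k v₁ v₂ → IsValue v₁
  right : ∀ {k v₁ v₂}, R k v₁ v₂ → IsValue v₂
  mono : ∀ {k j v₁ v₂}, j ≤ k → R k v₁ v₂ → R j v₁ v₂

/-- The lift of a relation on values to terms: if `e₁` evaluates within the step budget `k`, then
`e₂` evaluates, and the values are related at the remaining budget. -/
def ExpRel (R : SemTy S) : SemTy S := fun k e₁ e₂ =>
  ∀ n ≤ k, ∀ v₁, Eval e₁ n v₁ → ∃ m v₂, Eval e₂ m v₂ ∧ R (k - n) v₁ v₂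

theorem SemTy.Good.expRel {R : SemTy S} (hR : R.Good) {k : ℕ} {v₁ v₂ : Tm S}
    (h : R k v₁ v₂) : ExpRel R k v₁ v₂ := by
  intro n _ r hr
  obtain ⟨rfl, rfl⟩ := (hR.left h).eval_inv hr
  exact ⟨0, v₂, (hR.right h).eval, h⟩

/-- Folded values whose contents are related at all strictly smaller step indices. -/
def foldRel (R : SemTy S) : SemTy S := fun k v₁ v₂ =>
  ∃ τ₁ τ₂ u₁ u₂, v₁ = .fold τ₁ u₁ ∧ v₂ = .fold τ₂ u₂ ∧ IsValue u₁ ∧ IsValue u₂ ∧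
    ∀ j < k, R j u₁ u₂

/-- The iterates of `foldRel ∘ F`, starting from the empty relation. -/
def iterRel (F : SemTy S → SemTy S) : ℕ → SemTy S
  | 0 => fun _ _ _ => False
  | n + 1 => foldRel (F (iterRel F n))

/-- The fixed point of `foldRel ∘ F`. At index `k` the iterates are constant from the `k + 1`-st
one on, provided that `F` is nonexpansive. -/
def fixRel (F : SemTy S → SemTy S) : SemTy S := fun k => iterRel F (k + 1) k

/-- `F R` at index `k` only depends on `R` up to index `k`. -/
def Nonexpansive (F : SemTy S → SemTy S) : Prop :=
  ∀ (R R' : SemTy S) (k : ℕ), (∀ j ≤ k, R j = R' j) → F R k = F R' k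

theorem foldRel_good (R : SemTy S) : (foldRel R).Good where
  left := by rintro k _ _ ⟨τ₁, τ₂, u₁, u₂, rfl, rfl, h₁, h₂, -⟩; exact h₁.fold _
  right := by rintro k _ _ ⟨τ₁, τ₂, u₁, u₂, rfl, rfl, h₁, h₂, -⟩; exact h₂.fold _
  mono := by
    rintro k j _ _ hjk ⟨τ₁, τ₂, u₁, u₂, rfl, rfl, h₁, h₂, h⟩
    exact ⟨τ₁, τ₂, u₁, u₂, rfl, rfl, h₁, h₂, fun i hi => h i (by omega)⟩

theorem foldRel_congr {R R' : SemTy S} {k : ℕ} (h : ∀ j < k, R j = R' j) :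
    foldRel R k = foldRel R' k := by
  funext v₁ v₂
  have : ∀ u₁ u₂, (∀ j < k, R j u₁ u₂) ↔ ∀ j < k, R' j u₁ u₂ := fun u₁ u₂ =>
    forall₂_congr fun j hj => by rw [h j hj]
  simp only [foldRel, this]

theorem iterRel_stable {F : SemTy S → SemTy S} (hF : Nonexpansive F) (k : ℕ) :
    ∀ m n, k < m → k < n → iterRel F m k = iterRel F n k := by
  induction k using Nat.strong_induction_on with
  | _ k ih =>
    intro m n hm hn
    obtain ⟨m, rfl⟩ := Nat.exists_eq_succ_of_ne_zero (by omega : m ≠ 0)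
    obtain ⟨n, rfl⟩ := Nat.exists_eq_succ_of_ne_zero (by omega : n ≠ 0)
    exact foldRel_congr fun j hj => hF _ _ _ fun i hi =>
      ih i (by omega) _ _ (by omega) (by omega)

theorem fixRel_eq {F : SemTy S → SemTy S} (hF : Nonexpansive F) :
    fixRel F = foldRel (F (fixRel F)) := by
  funext k
  exact foldRel_congr fun j hj => hF _ _ _ fun i hi =>
    iterRel_stable hF i _ _ (by omega) (by omega)

theorem fixRel_congr {F F' : SemTy S → SemTy S} {k : ℕ}
    (h : ∀ j ≤ k, ∀ R R' : SemTy S, (∀ i ≤ j, R i = R' i) → F R j = F' R' j) :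
    fixRel F k = fixRel F' k := by
  have key : ∀ n, ∀ j ≤ k, iterRel F n j = iterRel F' n j := by
    intro n
    induction n with
    | zero => intro _ _; rfl
    | succ n ih =>
      intro j hj
      exact foldRel_congr fun i hi => h i (by omega) _ _ fun l hl => ih l (by omega)
  exact key _ _ le_rfl

end Relations

/-! ### The relational interpretation of types -/

section Interpretation

variable {S : PrimSig}

/-- The relational interpretation of a type, where `ρ` interprets the free type variables.
Functions and polymorphic values are related if they send related arguments, respectively all
relations, to related results at every smaller index; the syntactic types at which polymorphic
values are instantiated are arbitrary, as are all type annotations. -/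
def ValRel : Ty → (ℕ → SemTy S) → SemTy S
  | .var i, ρ => ρ i
  | .unit, _ => fun _ v₁ v₂ => v₁ = .unit ∧ v₂ = .unit
  | .int, _ => fun _ v₁ v₂ => ∃ n, v₁ = .int n ∧ v₂ = .int n
  | .bool, _ => fun _ v₁ v₂ => v₁ = .tru ∧ v₂ = .tru ∨ v₁ = .fls ∧ v₂ = .fls
  | .prod τ₁ τ₂, ρ => fun k v₁ v₂ => ∃ a₁ b₁ a₂ b₂, v₁ = .pair a₁ b₁ ∧ v₂ = .pair a₂ b₂ ∧
      ValRel τ₁ ρ k a₁ a₂ ∧ ValRel τ₂ ρ k b₁ b₂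
  | .sum τ₁ τ₂, ρ => fun k v₁ v₂ => ∃ σ₁ σ₂ u₁ u₂,
      v₁ = .inl σ₁ u₁ ∧ v₂ = .inl σ₂ u₂ ∧ ValRel τ₁ ρ k u₁ u₂ ∨
      v₁ = .inr σ₁ u₁ ∧ v₂ = .inr σ₂ u₂ ∧ ValRel τ₂ ρ k u₁ u₂
  | .arr τ₁ τ₂, ρ => fun k v₁ v₂ => IsValue v₁ ∧ IsValue v₂ ∧ ∀ j ≤ k, ∀ u₁ u₂,
      ValRel τ₁ ρ j u₁ u₂ → ExpRel (ValRel τ₂ ρ) j (.app v₁ u₁) (.app v₂ u₂)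
  | .all τ, ρ => fun k v₁ v₂ => IsValue v₁ ∧ IsValue v₂ ∧ ∀ R : SemTy S, R.Good →
      ∀ σ₁ σ₂, ∀ j ≤ k, ExpRel (ValRel τ (scons R ρ)) j (.tapp v₁ σ₁) (.tapp v₂ σ₂)
  | .ex τ, ρ => fun k v₁ v₂ => ∃ R : SemTy S, R.Good ∧ ∃ σ₁ σ₂ τ₁ τ₂ u₁ u₂,
      v₁ = .pack σ₁ u₁ τ₁ ∧ v₂ = .pack σ₂ u₂ τ₂ ∧ ValRel τ (scons R ρ) k u₁ u₂
  | .mu τ, ρ => fixRel fun R => ValRel τ (scons R ρ)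

theorem expRel_congr {R R' : SemTy S} {k : ℕ} (h : ∀ j ≤ k, R j = R' j) :
    ExpRel R k = ExpRel R' k := by
  funext e₁ e₂
  have : ∀ n, R (k - n) = R' (k - n) := fun n => h _ (Nat.sub_le _ _)
  simp only [ExpRel, this]

theorem scons_agree {R R' : SemTy S} {ρ ρ' : ℕ → SemTy S} {k : ℕ} (hR : ∀ j ≤ k, R j = R' j)
    (h : ∀ i, ∀ j ≤ k, ρ i j = ρ' i j) : ∀ i, ∀ j ≤ k, scons R ρ i j = scons R' ρ' i j
  | 0 => hR
  | i + 1 => h i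

/-- The interpretation of a type at index `k` only depends on the interpretations of its type
variables up to index `k`; hence the fixed point interpreting a recursive type can be unrolled. -/
theorem valRel_congr (τ : Ty) : ∀ {ρ ρ' : ℕ → SemTy S} {k : ℕ},
    (∀ i, ∀ j ≤ k, ρ i j = ρ' i j) → ValRel τ ρ k = ValRel τ ρ' k := by
  induction τ with
  | var i => exact fun h => h i _ le_rfl
  | unit => intros; rfl
  | int => intros; rfl
  | bool => intros; rfl
  | prod τ₁ τ₂ ih₁ ih₂ => intro ρ ρ' k h; simp only [ValRel, ih₁ h, ih₂ h]
  | sum τ₁ τ₂ ih₁ ih₂ => intro ρ ρ' k h; simp only [ValRel, ih₁ h, ih₂ h]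
  | arr τ₁ τ₂ ih₁ ih₂ =>
    intro ρ ρ' k h
    funext v₁ v₂
    refine propext (and_congr_right' (and_congr_right' (forall₂_congr fun j hj => ?_)))
    rw [ih₁ fun i l hl => h i l (hl.trans hj),
      expRel_congr fun l hl => ih₂ fun i l' hl' => h i l' ((hl'.trans hl).trans hj)]
  | all τ ih =>
    intro ρ ρ' k h
    funext v₁ v₂
    refine propext (and_congr_right' (and_congr_right' (forall₂_congr fun R _ =>
      forall₂_congr fun σ₁ σ₂ => forall₂_congr fun j hj => ?_)))
    rw [expRel_congr fun l hl => ih <| scons_agree (fun _ _ => rfl)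
      fun i l' hl' => h i l' ((hl'.trans hl).trans hj)]
  | ex τ ih =>
    intro ρ ρ' k h
    have : ∀ R : SemTy S, ValRel τ (scons R ρ) k = ValRel τ (scons R ρ') k := fun R =>
      ih <| scons_agree (fun _ _ => rfl) h
    simp only [ValRel, this]
  | mu τ ih =>
    intro ρ ρ' k h
    exact fixRel_congr fun j hj R R' hR => ih <| scons_agree hR fun i l hl => h i l (hl.trans hj)

theorem valRel_mu (τ : Ty) (ρ : ℕ → SemTy S) :
    ValRel (.mu τ) ρ = foldRel (ValRel τ (scons (ValRel (.mu τ) ρ) ρ)) :=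
  fixRel_eq fun _ _ _ h => valRel_congr τ <| scons_agree h fun _ _ _ => rfl

theorem good_scons {R : SemTy S} {ρ : ℕ → SemTy S} (hR : R.Good) (hρ : ∀ i, (ρ i).Good) :
    ∀ i, (scons R ρ i).Good
  | 0 => hR
  | i + 1 => hρ i

theorem valRel_good (τ : Ty) : ∀ {ρ : ℕ → SemTy S}, (∀ i, (ρ i).Good) → (ValRel τ ρ).Good := by
  induction τ with
  | var i => exact fun hρ => hρ i
  | unit =>
    intro ρ _
    refine ⟨?_, ?_, fun _ h => h⟩ <;> rintro k _ _ ⟨rfl, rfl⟩ <;> constructor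
  | int =>
    intro ρ _
    refine ⟨?_, ?_, fun _ h => h⟩ <;> rintro k _ _ ⟨n, rfl, rfl⟩ <;> constructor
  | bool =>
    intro ρ _
    refine ⟨?_, ?_, fun _ h => h⟩ <;> rintro k _ _ (⟨rfl, rfl⟩ | ⟨rfl, rfl⟩) <;> constructor
  | prod τ₁ τ₂ ih₁ ih₂ =>
    intro ρ hρ
    refine ⟨?_, ?_, ?_⟩
    · rintro k _ _ ⟨a₁, b₁, a₂, b₂, rfl, rfl, ha, hb⟩
      exact ((ih₁ hρ).left ha).pair ((ih₂ hρ).left hb)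
    · rintro k _ _ ⟨a₁, b₁, a₂, b₂, rfl, rfl, ha, hb⟩
      exact ((ih₁ hρ).right ha).pair ((ih₂ hρ).right hb)
    · rintro k j _ _ hjk ⟨a₁, b₁, a₂, b₂, rfl, rfl, ha, hb⟩
      exact ⟨a₁, b₁, a₂, b₂, rfl, rfl, (ih₁ hρ).mono hjk ha, (ih₂ hρ).mono hjk hb⟩
  | sum τ₁ τ₂ ih₁ ih₂ =>
    intro ρ hρ
    refine ⟨?_, ?_, ?_⟩
    · rintro k _ _ ⟨σ₁, σ₂, u₁, u₂, ⟨rfl, rfl, h⟩ | ⟨rfl, rfl, h⟩⟩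
      · exact ((ih₁ hρ).left h).inl _
      · exact ((ih₂ hρ).left h).inr _
    · rintro k _ _ ⟨σ₁, σ₂, u₁, u₂, ⟨rfl, rfl, h⟩ | ⟨rfl, rfl, h⟩⟩
      · exact ((ih₁ hρ).right h).inl _
      · exact ((ih₂ hρ).right h).inr _
    · rintro k j _ _ hjk ⟨σ₁, σ₂, u₁, u₂, ⟨rfl, rfl, h⟩ | ⟨rfl, rfl, h⟩⟩
      · exact ⟨σ₁, σ₂, u₁, u₂, .inl ⟨rfl, rfl, (ih₁ hρ).mono hjk h⟩⟩
      · exact ⟨σ₁, σ₂, u₁, u₂, .inr ⟨rfl, rfl, (ih₂ hρ).mono hjk h⟩⟩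
  | arr τ₁ τ₂ ih₁ ih₂ =>
    intro ρ hρ
    exact ⟨fun h => h.1, fun h => h.2.1, fun hjk h =>
      ⟨h.1, h.2.1, fun i hi => h.2.2 i (hi.trans hjk)⟩⟩
  | all τ ih =>
    intro ρ hρ
    exact ⟨fun h => h.1, fun h => h.2.1, fun hjk h =>
      ⟨h.1, h.2.1, fun R hR σ₁ σ₂ i hi => h.2.2 R hR σ₁ σ₂ i (hi.trans hjk)⟩⟩
  | ex τ ih =>
    intro ρ hρ
    refine ⟨?_, ?_, ?_⟩
    · rintro k _ _ ⟨R, hR, σ₁, σ₂, τ₁, τ₂, u₁, u₂, rfl, rfl, h⟩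
      exact ((ih (good_scons hR hρ)).left h).pack _ _
    · rintro k _ _ ⟨R, hR, σ₁, σ₂, τ₁, τ₂, u₁, u₂, rfl, rfl, h⟩
      exact ((ih (good_scons hR hρ)).right h).pack _ _
    · rintro k j _ _ hjk ⟨R, hR, σ₁, σ₂, τ₁, τ₂, u₁, u₂, rfl, rfl, h⟩
      exact ⟨R, hR, σ₁, σ₂, τ₁, τ₂, u₁, u₂, rfl, rfl, (ih (good_scons hR hρ)).mono hjk h⟩
  | mu τ =>
    intro ρ _
    rw [valRel_mu]
    exact foldRel_good _

theorem valRel_rename (τ : Ty) : ∀ (ξ : ℕ → ℕ) (ρ : ℕ → SemTy S),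
    ValRel (τ.rename ξ) ρ = ValRel τ fun i => ρ (ξ i) := by
  induction τ <;> intro ξ ρ <;> simp_all [Ty.rename, ValRel, scons_comp_upRen]

theorem valRel_shift (τ : Ty) (R : SemTy S) (ρ : ℕ → SemTy S) :
    ValRel τ.shift (scons R ρ) = ValRel τ ρ :=
  valRel_rename τ _ _

theorem valRel_up (θ : ℕ → Ty) (R : SemTy S) (ρ : ℕ → SemTy S) :
    (fun i => ValRel (Ty.up θ i) (scons R ρ)) = scons R fun i => ValRel (θ i) ρ := by
  funext i
  cases i
  · rfl
  · exact valRel_shift _ _ _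

theorem valRel_subst (τ : Ty) : ∀ (θ : ℕ → Ty) (ρ : ℕ → SemTy S),
    ValRel (τ.subst θ) ρ = ValRel τ fun i => ValRel (θ i) ρ := by
  induction τ <;> intro θ ρ <;> simp_all [Ty.subst, ValRel, valRel_up]

theorem valRel_inst (τ τ₁ : Ty) (ρ : ℕ → SemTy S) :
    ValRel (τ.inst τ₁) ρ = ValRel τ (scons (ValRel τ₁ ρ) ρ) := by
  rw [Ty.inst, valRel_subst]
  congr 1
  funext i
  cases i <;> rfl

theorem valRel_base_refl (b : Base) (a : b.Val) (ρ : ℕ → SemTy S) (k : ℕ) :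
    ValRel b.toTy ρ k (b.toTm a) (b.toTm a) := by
  cases b with
  | unit => exact ⟨rfl, rfl⟩
  | int => exact ⟨a, rfl, rfl⟩
  | bool => cases a <;> simp [Base.toTy, ValRel, Base.toTm]

theorem valRel_base_eq {b : Base} {ρ : ℕ → SemTy S} {k : ℕ} {v₁ v₂ : Tm S}
    (h : ValRel b.toTy ρ k v₁ v₂) : v₁ = v₂ := by
  cases b with
  | unit => obtain ⟨rfl, rfl⟩ := h; rfl
  | int => obtain ⟨n, rfl, rfl⟩ := h; rfl
  | bool => obtain ⟨rfl, rfl⟩ | ⟨rfl, rfl⟩ := h <;> rfl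

end Interpretation

/-! ### Compatibility of the logical relation with the term constructors -/

section Compatibility

variable {S : PrimSig}

/-- Two substitutions send the term variables of `Γ` to related values. They have to take values
everywhere, so that they map values to values. -/
structure EnvRel (ρ : ℕ → SemTy S) (k : ℕ) (Γ : List Ty) (γ₁ γ₂ : ℕ → Tm S) : Prop where
  left : ∀ x, IsValue (γ₁ x)
  right : ∀ x, IsValue (γ₂ x)
  lookup : ∀ x τ, Γ[x]? = some τ → ValRel τ ρ k (γ₁ x) (γ₂ x)

theorem EnvRel.mono {ρ : ℕ → SemTy S} (hρ : ∀ i, (ρ i).Good) {k j : ℕ} {Γ : List Ty}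
    {γ₁ γ₂ : ℕ → Tm S} (h : EnvRel ρ k Γ γ₁ γ₂) (hjk : j ≤ k) : EnvRel ρ j Γ γ₁ γ₂ :=
  ⟨h.left, h.right, fun x τ hx => (valRel_good τ hρ).mono hjk (h.lookup x τ hx)⟩

theorem EnvRel.cons {ρ : ℕ → SemTy S} (hρ : ∀ i, (ρ i).Good) {k : ℕ} {Γ : List Ty}
    {γ₁ γ₂ : ℕ → Tm S} (h : EnvRel ρ k Γ γ₁ γ₂) {τ : Ty} {u₁ u₂ : Tm S}
    (hu : ValRel τ ρ k u₁ u₂) : EnvRel ρ k (τ :: Γ) (scons u₁ γ₁) (scons u₂ γ₂) where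
  left
    | 0 => (valRel_good τ hρ).left hu
    | x + 1 => h.left x
  right
    | 0 => (valRel_good τ hρ).right hu
    | x + 1 => h.right x
  lookup
    | 0, _, rfl => hu
    | x + 1, σ, hx => h.lookup x σ hx

theorem EnvRel.shift {ρ : ℕ → SemTy S} {k : ℕ} {Γ : List Ty} {γ₁ γ₂ : ℕ → Tm S}
    (h : EnvRel ρ k Γ γ₁ γ₂) (R : SemTy S) :
    EnvRel (scons R ρ) k (Γ.map Ty.shift) γ₁ γ₂ where
  left := h.left
  right := h.right
  lookup x τ hx := by
    rw [List.getElem?_map, Option.map_eq_some_iff] at hx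
    obtain ⟨σ, hσ, rfl⟩ := hx
    rw [valRel_shift]
    exact h.lookup x σ hσ

/-- The logical approximation of open terms. Since `ρ` interprets all type variables, the number
of type variables in scope need not be recorded. -/
def LogRel (Γ : List Ty) (e₁ e₂ : Tm S) (τ : Ty) : Prop :=
  ∀ (ρ : ℕ → SemTy S), (∀ i, (ρ i).Good) → ∀ (θ₁ θ₂ : ℕ → Ty) (k : ℕ) (γ₁ γ₂ : ℕ → Tm S),
    EnvRel ρ k Γ γ₁ γ₂ → ExpRel (ValRel τ ρ) k (e₁.subst θ₁ γ₁) (e₂.subst θ₂ γ₂)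

theorem ExpRel.app {ρ : ℕ → SemTy S} (hρ : ∀ i, (ρ i).Good) {k : ℕ} {τ₁ τ₂ : Ty}
    {e₁ e₂ e₁' e₂' : Tm S} (h : ExpRel (ValRel (.arr τ₁ τ₂) ρ) k e₁ e₂)
    (h' : ExpRel (ValRel τ₁ ρ) k e₁' e₂') :
    ExpRel (ValRel τ₂ ρ) k (.app e₁ e₁') (.app e₂ e₂') := by
  intro n hn r hr
  cases hr with
  | @app σ _ _ b u _ n₁ n₂ n₃ hg hu hb =>
    obtain ⟨m, g, hg₂, hgg⟩ := h n₁ (by omega) _ hg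
    obtain ⟨m', u', hu₂, huu⟩ := h' n₂ (by omega) _ hu
    obtain ⟨l, r', hr₂, hrr⟩ := hgg.2.2 (k - n₁ - n₂) (by omega) u u'
      ((valRel_good τ₁ hρ).mono (by omega) huu) (0 + 0 + n₃) (by omega) r
      (.app (.lam σ b) hu.isValue.eval hb)
    obtain ⟨l', hl'⟩ := hg₂.app_of_app hu₂ hr₂
    exact ⟨l', r', hl', by convert hrr using 1; omega⟩

theorem ExpRel.tapp {ρ : ℕ → SemTy S} {k : ℕ} {τ : Ty} {e₁ e₂ : Tm S}
    (h : ExpRel (ValRel (.all τ) ρ) k e₁ e₂) {R : SemTy S} (hR : R.Good) (σ₁ σ₂ : Ty) :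
    ExpRel (ValRel τ (scons R ρ)) k (.tapp e₁ σ₁) (.tapp e₂ σ₂) := by
  intro n hn r hr
  cases hr with
  | @tapp _ _ b _ n₁ n₂ hg hb =>
    obtain ⟨m, g, hg₂, hgg⟩ := h n₁ (by omega) _ hg
    obtain ⟨l, r', hr₂, hrr⟩ := hgg.2.2 R hR σ₁ σ₂ (k - n₁) le_rfl (0 + n₂) (by omega) r
      (.tapp (.tlam b) hb)
    obtain ⟨l', hl'⟩ := hg₂.tapp_of_tapp hr₂
    exact ⟨l', r', hl', by convert hrr using 1; omega⟩

namespace LogRel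

variable {Γ : List Ty}

theorem var {x : ℕ} {τ : Ty} (hx : Γ[x]? = some τ) : LogRel Γ (.var x : Tm S) (.var x) τ :=
  fun _ hρ _ _ _ _ _ hγ => (valRel_good τ hρ).expRel (hγ.lookup x τ hx)

theorem unit : LogRel Γ (.unit : Tm S) .unit .unit :=
  fun _ hρ _ _ _ _ _ _ => (valRel_good .unit hρ).expRel ⟨rfl, rfl⟩

theorem int (n : ℤ) : LogRel Γ (.int n : Tm S) (.int n) .int :=
  fun _ hρ _ _ _ _ _ _ => (valRel_good .int hρ).expRel ⟨n, rfl, rfl⟩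

theorem tru : LogRel Γ (.tru : Tm S) .tru .bool :=
  fun _ hρ _ _ _ _ _ _ => (valRel_good .bool hρ).expRel (.inl ⟨rfl, rfl⟩)

theorem fls : LogRel Γ (.fls : Tm S) .fls .bool :=
  fun _ hρ _ _ _ _ _ _ => (valRel_good .bool hρ).expRel (.inr ⟨rfl, rfl⟩)

theorem op {o : PrimOp S} {args args' : Fin o.arity → Tm S}
    (h : ∀ i, LogRel Γ (args i) (args' i) (o.argTy i).toTy) :
    LogRel Γ (.op o args) (.op o args') o.resTy.toTy := by
  intro ρ hρ θ₁ θ₂ k γ₁ γ₂ hγ n hn r hr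
  cases hr with
  | op n a ha =>
    have : ∀ i, ∃ m, Eval ((args' i).subst θ₂ γ₂) m ((o.argTy i).toTm (a i)) := by
      intro i
      have hi : n i ≤ k :=
        (Finset.single_le_sum (fun _ _ => Nat.zero_le _) (Finset.mem_univ i)).trans hn
      obtain ⟨m, v, hv, hvv⟩ := h i ρ hρ θ₁ θ₂ k γ₁ γ₂ hγ (n i) hi _ (ha i)
      rw [valRel_base_eq hvv]
      exact ⟨m, hv⟩
    choose m hm using this
    exact ⟨_, _, .op m a hm, valRel_base_refl _ _ _ _⟩

theorem ite {τ : Ty} {e e₁ e₂ e' e₁' e₂' : Tm S} (h : LogRel Γ e e' .bool)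
    (h₁ : LogRel Γ e₁ e₁' τ) (h₂ : LogRel Γ e₂ e₂' τ) :
    LogRel Γ (.ite e e₁ e₂) (.ite e' e₁' e₂') τ := by
  intro ρ hρ θ₁ θ₂ k γ₁ γ₂ hγ n hn r hr
  cases hr with
  | @iteTrue _ _ _ _ n₁ n₂ hc hb =>
    obtain ⟨m, c, hc', hcc⟩ := h ρ hρ θ₁ θ₂ k γ₁ γ₂ hγ n₁ (by omega) _ hc
    obtain ⟨-, rfl⟩ | ⟨h, -⟩ := hcc
    · obtain ⟨l, r', hr', hrr⟩ := h₁ ρ hρ θ₁ θ₂ (k - n₁) γ₁ γ₂ (hγ.mono hρ (by omega)) n₂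
        (by omega) _ hb
      exact ⟨_, r', .iteTrue hc' hr', by rwa [← Nat.sub_sub]⟩
    · cases h
  | @iteFalse _ _ _ _ n₁ n₂ hc hb =>
    obtain ⟨m, c, hc', hcc⟩ := h ρ hρ θ₁ θ₂ k γ₁ γ₂ hγ n₁ (by omega) _ hc
    obtain ⟨h, -⟩ | ⟨-, rfl⟩ := hcc
    · cases h
    · obtain ⟨l, r', hr', hrr⟩ := h₂ ρ hρ θ₁ θ₂ (k - n₁) γ₁ γ₂ (hγ.mono hρ (by omega)) n₂
        (by omega) _ hb
      exact ⟨_, r', .iteFalse hc' hr', by rwa [← Nat.sub_sub]⟩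

theorem pair {τ₁ τ₂ : Ty} {e₁ e₂ e₁' e₂' : Tm S} (h₁ : LogRel Γ e₁ e₁' τ₁)
    (h₂ : LogRel Γ e₂ e₂' τ₂) : LogRel Γ (.pair e₁ e₂) (.pair e₁' e₂') (.prod τ₁ τ₂) := by
  intro ρ hρ θ₁ θ₂ k γ₁ γ₂ hγ n hn r hr
  cases hr with
  | @pair _ _ a b n₁ n₂ ha hb =>
    obtain ⟨m, a', ha', haa⟩ := h₁ ρ hρ θ₁ θ₂ k γ₁ γ₂ hγ n₁ (by omega) _ ha
    obtain ⟨l, b', hb', hbb⟩ := h₂ ρ hρ θ₁ θ₂ k γ₁ γ₂ hγ n₂ (by omega) _ hb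
    exact ⟨_, _, .pair ha' hb', a, b, a', b', rfl, rfl,
      (valRel_good τ₁ hρ).mono (by omega) haa, (valRel_good τ₂ hρ).mono (by omega) hbb⟩

theorem fst {τ₁ τ₂ : Ty} {e e' : Tm S} (h : LogRel Γ e e' (.prod τ₁ τ₂)) :
    LogRel Γ (.fst e) (.fst e') τ₁ := by
  intro ρ hρ θ₁ θ₂ k γ₁ γ₂ hγ n hn r hr
  cases hr with
  | fst he =>
    obtain ⟨m, _, hv, _, _, a, b, h, rfl, ha, -⟩ := h ρ hρ θ₁ θ₂ k γ₁ γ₂ hγ n hn _ he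
    cases h
    exact ⟨m, a, .fst hv, ha⟩

theorem snd {τ₁ τ₂ : Ty} {e e' : Tm S} (h : LogRel Γ e e' (.prod τ₁ τ₂)) :
    LogRel Γ (.snd e) (.snd e') τ₂ := by
  intro ρ hρ θ₁ θ₂ k γ₁ γ₂ hγ n hn r hr
  cases hr with
  | snd he =>
    obtain ⟨m, _, hv, _, _, a, b, h, rfl, -, hb⟩ := h ρ hρ θ₁ θ₂ k γ₁ γ₂ hγ n hn _ he
    cases h
    exact ⟨m, b, .snd hv, hb⟩

theorem inl {τ₁ τ₂ : Ty} (σ : Ty) {e e' : Tm S} (h : LogRel Γ e e' τ₁) :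
    LogRel Γ (.inl σ e) (.inl σ e') (.sum τ₁ τ₂) := by
  intro ρ hρ θ₁ θ₂ k γ₁ γ₂ hγ n hn r hr
  cases hr with
  | inl he =>
    obtain ⟨m, v, hv, hvv⟩ := h ρ hρ θ₁ θ₂ k γ₁ γ₂ hγ n hn _ he
    exact ⟨m, _, .inl hv, _, _, _, _, .inl ⟨rfl, rfl, hvv⟩⟩

theorem inr {τ₁ τ₂ : Ty} (σ : Ty) {e e' : Tm S} (h : LogRel Γ e e' τ₂) :
    LogRel Γ (.inr σ e) (.inr σ e') (.sum τ₁ τ₂) := by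
  intro ρ hρ θ₁ θ₂ k γ₁ γ₂ hγ n hn r hr
  cases hr with
  | inr he =>
    obtain ⟨m, v, hv, hvv⟩ := h ρ hρ θ₁ θ₂ k γ₁ γ₂ hγ n hn _ he
    exact ⟨m, _, .inr hv, _, _, _, _, .inr ⟨rfl, rfl, hvv⟩⟩

/-- The body of a binder, instantiated with related values. -/
theorem inst {τ₁ τ₂ : Ty} {e e' : Tm S} (h : LogRel (τ₁ :: Γ) e e' τ₂) {ρ : ℕ → SemTy S}
    (hρ : ∀ i, (ρ i).Good) (θ₁ θ₂ : ℕ → Ty) {k : ℕ} {γ₁ γ₂ : ℕ → Tm S}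
    (hγ : EnvRel ρ k Γ γ₁ γ₂) {j : ℕ} (hj : j ≤ k) {u₁ u₂ : Tm S} (hu : ValRel τ₁ ρ j u₁ u₂) :
    ExpRel (ValRel τ₂ ρ) j ((e.subst θ₁ (Tm.up γ₁)).inst u₁)
      ((e'.subst θ₂ (Tm.up γ₂)).inst u₂) := by
  rw [Tm.inst_subst, Tm.inst_subst]
  exact h ρ hρ _ _ _ _ _ ((hγ.mono hρ hj).cons hρ hu)

theorem case {τ₁ τ₂ τ : Ty} {e e₁ e₂ e' e₁' e₂' : Tm S} (h : LogRel Γ e e' (.sum τ₁ τ₂))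
    (h₁ : LogRel (τ₁ :: Γ) e₁ e₁' τ) (h₂ : LogRel (τ₂ :: Γ) e₂ e₂' τ) :
    LogRel Γ (.case e e₁ e₂) (.case e' e₁' e₂') τ := by
  intro ρ hρ θ₁ θ₂ k γ₁ γ₂ hγ n hn r hr
  cases hr with
  | @caseInl _ _ _ _ u _ n₁ n₂ he hb =>
    obtain ⟨m, _, hv, _, _, _, u', ⟨h, rfl, hu⟩ | ⟨h, -, -⟩⟩ :=
      h ρ hρ θ₁ θ₂ k γ₁ γ₂ hγ n₁ (by omega) _ he
    · cases h
      obtain ⟨l, r', hr', hrr⟩ := h₁.inst hρ θ₁ θ₂ hγ (Nat.sub_le k n₁) hu n₂ (by omega) _ hb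
      exact ⟨_, r', .caseInl hv hr', by rwa [← Nat.sub_sub]⟩
    · cases h
  | @caseInr _ _ _ _ u _ n₁ n₂ he hb =>
    obtain ⟨m, _, hv, _, _, _, u', ⟨h, -, -⟩ | ⟨h, rfl, hu⟩⟩ :=
      h ρ hρ θ₁ θ₂ k γ₁ γ₂ hγ n₁ (by omega) _ he
    · cases h
    · cases h
      obtain ⟨l, r', hr', hrr⟩ := h₂.inst hρ θ₁ θ₂ hγ (Nat.sub_le k n₁) hu n₂ (by omega) _ hb
      exact ⟨_, r', .caseInr hv hr', by rwa [← Nat.sub_sub]⟩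

theorem lam {τ₁ τ₂ : Ty} (σ : Ty) {e e' : Tm S} (h : LogRel (τ₁ :: Γ) e e' τ₂) :
    LogRel Γ (.lam σ e) (.lam σ e') (.arr τ₁ τ₂) := by
  intro ρ hρ θ₁ θ₂ k γ₁ γ₂ hγ
  refine (valRel_good (.arr τ₁ τ₂) hρ).expRel ⟨.lam _ _, .lam _ _, ?_⟩
  intro j hj u₁ u₂ hu n hn r hr
  cases hr with
  | @app _ _ _ _ _ _ n₁ n₂ n₃ hg hu' hb =>
    cases hg
    obtain ⟨rfl, rfl⟩ := ((valRel_good τ₁ hρ).left hu).eval_inv hu'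
    obtain ⟨l, r', hr', hrr⟩ := h.inst hρ θ₁ θ₂ hγ hj hu n₃ (by omega) _ hb
    exact ⟨_, r', .app (.lam _ _) ((valRel_good τ₁ hρ).right hu).eval hr', by simpa using hrr⟩

theorem app {τ₁ τ₂ : Ty} {e₁ e₂ e₁' e₂' : Tm S} (h₁ : LogRel Γ e₁ e₁' (.arr τ₁ τ₂))
    (h₂ : LogRel Γ e₂ e₂' τ₁) : LogRel Γ (.app e₁ e₂) (.app e₁' e₂') τ₂ :=
  fun ρ hρ θ₁ θ₂ k γ₁ γ₂ hγ =>
    (h₁ ρ hρ θ₁ θ₂ k γ₁ γ₂ hγ).app hρ (h₂ ρ hρ θ₁ θ₂ k γ₁ γ₂ hγ)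

theorem tlam {τ : Ty} {e e' : Tm S} (h : LogRel (Γ.map Ty.shift) e e' τ) :
    LogRel Γ (.tlam e) (.tlam e') (.all τ) := by
  intro ρ hρ θ₁ θ₂ k γ₁ γ₂ hγ
  refine (valRel_good (.all τ) hρ).expRel ⟨.tlam _, .tlam _, ?_⟩
  intro R hR σ₁ σ₂ j hj n hn r hr
  cases hr with
  | @tapp _ _ _ _ n₁ n₂ hg hb =>
    cases hg
    rw [Tm.tinst_subst] at hb
    obtain ⟨l, r', hr', hrr⟩ := h _ (good_scons hR hρ) (scons σ₁ θ₁) (scons σ₂ θ₂) j γ₁ γ₂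
      ((hγ.mono hρ hj).shift R) n₂ (by omega) _ hb
    rw [← Tm.tinst_subst] at hr'
    exact ⟨_, r', .tapp (.tlam _) hr', by simpa using hrr⟩

theorem tapp {τ : Ty} {e e' : Tm S} (h : LogRel Γ e e' (.all τ)) (σ : Ty) :
    LogRel Γ (.tapp e σ) (.tapp e' σ) (τ.inst σ) := by
  intro ρ hρ θ₁ θ₂ k γ₁ γ₂ hγ
  rw [valRel_inst]
  exact (h ρ hρ θ₁ θ₂ k γ₁ γ₂ hγ).tapp (valRel_good σ hρ) _ _

theorem pack {τ σ : Ty} {e e' : Tm S} (h : LogRel Γ e e' (τ.inst σ)) :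
    LogRel Γ (.pack σ e τ) (.pack σ e' τ) (.ex τ) := by
  intro ρ hρ θ₁ θ₂ k γ₁ γ₂ hγ n hn r hr
  cases hr with
  | pack he =>
    obtain ⟨m, v, hv, hvv⟩ := h ρ hρ θ₁ θ₂ k γ₁ γ₂ hγ n hn _ he
    rw [valRel_inst] at hvv
    exact ⟨m, _, .pack hv, _, valRel_good σ hρ, _, _, _, _, _, _, rfl, rfl, hvv⟩

theorem unpack {τ τ₁ : Ty} {e₁ e₂ e₁' e₂' : Tm S} (h₁ : LogRel Γ e₁ e₁' (.ex τ₁))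
    (h₂ : LogRel (τ₁ :: Γ.map Ty.shift) e₂ e₂' τ.shift) :
    LogRel Γ (.unpack e₁ e₂) (.unpack e₁' e₂') τ := by
  intro ρ hρ θ₁ θ₂ k γ₁ γ₂ hγ n hn r hr
  cases hr with
  | @unpack _ _ _ _ _ _ n₁ n₂ he hb =>
    obtain ⟨m, _, hv, R, hR, _, σ₂, _, _, _, u', h, rfl, hu⟩ :=
      h₁ ρ hρ θ₁ θ₂ k γ₁ γ₂ hγ n₁ (by omega) _ he
    cases h
    rw [Tm.unpackInst_subst] at hb
    obtain ⟨l, r', hr', hrr⟩ := h₂ _ (good_scons hR hρ) _ (scons σ₂ θ₂) (k - n₁) _ _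
      (((hγ.mono hρ (Nat.sub_le k n₁)).shift R).cons (good_scons hR hρ) hu) n₂ (by omega) _ hb
    rw [← Tm.unpackInst_subst] at hr'
    rw [valRel_shift, Nat.sub_sub] at hrr
    exact ⟨_, r', .unpack hv hr', hrr⟩

theorem fold {τ : Ty} (σ : Ty) {e e' : Tm S} (h : LogRel Γ e e' (τ.inst (.mu τ))) :
    LogRel Γ (.fold σ e) (.fold σ e') (.mu τ) := by
  intro ρ hρ θ₁ θ₂ k γ₁ γ₂ hγ n hn r hr
  cases hr with
  | fold he =>
    obtain ⟨m, v, hv, hvv⟩ := h ρ hρ θ₁ θ₂ k γ₁ γ₂ hγ n hn _ he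
    have hgood := valRel_good (τ.inst (.mu τ)) hρ
    refine ⟨m, _, .fold hv, ?_⟩
    rw [valRel_mu]
    refine ⟨_, _, _, _, rfl, rfl, hgood.left hvv, hgood.right hvv, fun j hj => ?_⟩
    rw [← valRel_inst]
    exact hgood.mono hj.le hvv

theorem unfold {τ : Ty} {e e' : Tm S} (h : LogRel Γ e e' (.mu τ)) :
    LogRel Γ (.unfold e) (.unfold e') (τ.inst (.mu τ)) := by
  intro ρ hρ θ₁ θ₂ k γ₁ γ₂ hγ n hn r hr
  cases hr with
  | @unfold _ _ _ n he =>
    obtain ⟨m, _, hv, hvv⟩ := h ρ hρ θ₁ θ₂ k γ₁ γ₂ hγ n (by omega) _ he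
    rw [valRel_mu] at hvv
    obtain ⟨_, _, _, u, h, rfl, -, -, hu⟩ := hvv
    cases h
    rw [valRel_inst]
    exact ⟨_, u, .unfold hv, hu _ (by omega)⟩

/-- Logical approximation is preserved by the renamings that let a context capture the free
variables of the terms in its hole. -/
theorem rename {Δ Δ' : ℕ} {Γ' : List Ty} {τ : Ty} {ξ ζ : ℕ → ℕ} {e e' : Tm S}
    (h : LogRel Γ e e' τ) (hi : CtxIncl Δ Γ Δ' Γ' ξ ζ) :
    LogRel Γ' (e.rename ξ ζ) (e'.rename ξ ζ) (τ.rename ξ) := by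
  intro ρ hρ θ₁ θ₂ k γ₁ γ₂ hγ
  rw [Tm.subst_rename, Tm.subst_rename, valRel_rename]
  refine h _ (fun i => hρ _) _ _ k _ _ ⟨fun x => hγ.left _, fun x => hγ.right _, ?_⟩
  intro x σ hx
  rw [← valRel_rename]
  exact hγ.lookup _ _ (hi.lookup x σ hx)

end LogRel

end Compatibility

/-! ### The fundamental theorem and soundness for contextual approximation -/

section Soundness

variable {S : PrimSig}

/-- The fundamental theorem of the logical relation: well-typed terms are related to themselves. -/
theorem HasType.logRel {Δ : ℕ} {Γ : List Ty} {e : Tm S} {τ : Ty} (h : HasType Δ Γ e τ) :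
    LogRel Γ e e τ := by
  induction h with
  | var hx => exact .var hx
  | unit => exact .unit
  | int n => exact .int n
  | op _ ih => exact .op ih
  | tru => exact .tru
  | fls => exact .fls
  | ite _ _ _ ih ih₁ ih₂ => exact .ite ih ih₁ ih₂
  | pair _ _ ih₁ ih₂ => exact .pair ih₁ ih₂
  | fst _ ih => exact .fst ih
  | snd _ ih => exact .snd ih
  | inl _ _ ih => exact .inl _ ih
  | inr _ _ ih => exact .inr _ ih
  | case _ _ _ ih ih₁ ih₂ => exact .case ih ih₁ ih₂
  | lam _ _ ih => exact .lam _ ih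
  | app _ _ ih₁ ih₂ => exact .app ih₁ ih₂
  | tlam _ ih => exact .tlam ih
  | tapp _ _ ih => exact .tapp ih _
  | pack _ _ ih => exact .pack ih
  | unpack _ _ _ ih₁ ih₂ => exact .unpack ih₁ ih₂
  | fold _ _ ih => exact .fold _ ih
  | unfold _ ih => exact .unfold ih

theorem CtxHasType.logRel {Δ₀ : ℕ} {Γ₀ : List Ty} {τ₀ : Ty} {e₁ e₂ : Tm S}
    (he : LogRel Γ₀ e₁ e₂ τ₀) {C : Ctx S} {Δ : ℕ} {Γ : List Ty} {τ : Ty}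
    (h : CtxHasType Δ₀ Γ₀ τ₀ C Δ Γ τ) : LogRel Γ (C.fill e₁) (C.fill e₂) τ := by
  induction h with
  | hole hi => exact he.rename hi
  | @op _ _ _ o i args ha _ ih =>
    refine .op fun j => ?_
    by_cases hj : j = i
    · subst hj
      simpa using ih
    · simpa [hj] using (ha j hj).logRel
  | ite₁ _ h₁ h₂ ih => exact .ite ih h₁.logRel h₂.logRel
  | ite₂ h₁ _ h₂ ih => exact .ite h₁.logRel ih h₂.logRel
  | ite₃ h₁ h₂ _ ih => exact .ite h₁.logRel h₂.logRel ih
  | pairL _ h ih => exact .pair ih h.logRel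
  | pairR h _ ih => exact .pair h.logRel ih
  | fst _ ih => exact .fst ih
  | snd _ ih => exact .snd ih
  | inl _ _ ih => exact .inl _ ih
  | inr _ _ ih => exact .inr _ ih
  | case₁ _ h₁ h₂ ih => exact .case ih h₁.logRel h₂.logRel
  | case₂ h₁ _ h₂ ih => exact .case h₁.logRel ih h₂.logRel
  | case₃ h₁ h₂ _ ih => exact .case h₁.logRel h₂.logRel ih
  | lam _ _ ih => exact .lam _ ih
  | appL _ h ih => exact .app ih h.logRel
  | appR h _ ih => exact .app h.logRel ih
  | tlam _ ih => exact .tlam ih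
  | tapp _ _ ih => exact .tapp ih _
  | pack _ _ ih => exact .pack ih
  | unpack₁ _ _ h ih => exact .unpack ih h.logRel
  | unpack₂ h _ _ ih => exact .unpack h.logRel ih
  | fold _ _ ih => exact .fold _ ih
  | unfold _ ih => exact .unfold ih

theorem emptyRel_good : SemTy.Good (fun _ _ _ => False : SemTy S) :=
  ⟨False.elim, False.elim, fun _ => id⟩

theorem EnvRel.nil {ρ : ℕ → SemTy S} {k : ℕ} {γ₁ γ₂ : ℕ → Tm S} (h₁ : ∀ x, IsValue (γ₁ x))
    (h₂ : ∀ x, IsValue (γ₂ x)) : EnvRel ρ k [] γ₁ γ₂ :=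
  ⟨h₁, h₂, fun _ _ h => by simp at h⟩

theorem LogRel.terminates {e₁ e₂ : Tm S} {τ : Ty} (h : LogRel [] e₁ e₂ τ)
    (h₁ : Terminates e₁) : Terminates e₂ := by
  rw [terminates_iff_eval] at h₁ ⊢
  obtain ⟨n, v, hv⟩ := h₁
  have := h _ (fun _ => emptyRel_good) Ty.var Ty.var n Tm.var Tm.var (.nil .var .var) n le_rfl v
  rw [Tm.subst_var, Tm.subst_var] at this
  obtain ⟨m, v', hv', -⟩ := this hv
  exact ⟨m, v', hv'⟩

theorem LogRel.ctxApprox {Δ : ℕ} {Γ : List Ty} {e₁ e₂ : Tm S} {τ : Ty} (h : LogRel Γ e₁ e₂ τ)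
    (h₁ : HasType Δ Γ e₁ τ) (h₂ : HasType Δ Γ e₂ τ) : CtxApprox Δ Γ e₁ e₂ τ :=
  ⟨h₁, h₂, fun _ _ hC ht => (hC.logRel h).terminates ht⟩

end Soundness

/-! ### The free theorem -/

section Choice

variable {S : PrimSig}

/-- The relation that consists of the two pairs `(a, a')` and `(b, b')`, at every step index. -/
def twoPointRel (a a' b b' : Tm S) : SemTy S := fun _ x y => x = a ∧ y = a' ∨ x = b ∧ y = b'

theorem twoPointRel_good {a a' b b' : Tm S} (ha : IsValue a) (ha' : IsValue a')
    (hb : IsValue b) (hb' : IsValue b') : (twoPointRel a a' b b').Good where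
  left := by rintro _ _ _ (⟨rfl, rfl⟩ | ⟨rfl, rfl⟩) <;> assumption
  right := by rintro _ _ _ (⟨rfl, rfl⟩ | ⟨rfl, rfl⟩) <;> assumption
  mono _ h := h

/-- Parametricity of the type `∀α. α → α → α` at the two-point relation: on the values `a, b` and
`a', b'`, related choice functions return results in corresponding positions. -/
theorem ExpRel.choice {ρ : ℕ → SemTy S} (hρ : ∀ i, (ρ i).Good) {k : ℕ} {h₁ h₂ : Tm S}
    (h : ExpRel (ValRel choiceTy ρ) k h₁ h₂) (σ₁ σ₂ : Ty) {a a' b b' : Tm S} (ha : IsValue a)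
    (ha' : IsValue a') (hb : IsValue b) (hb' : IsValue b') :
    ExpRel (twoPointRel a a' b b') k (.app (.app (.tapp h₁ σ₁) a) b)
      (.app (.app (.tapp h₂ σ₂) a') b') := by
  have hR := twoPointRel_good ha ha' hb hb'
  have hρ' := good_scons hR hρ
  exact ((h.tapp hR σ₁ σ₂).app hρ' (τ₁ := .var 0) (hR.expRel (.inl ⟨rfl, rfl⟩))).app hρ'
    (τ₁ := .var 0) (τ₂ := .var 0) (hR.expRel (.inr ⟨rfl, rfl⟩))

variable {τ σ : Ty} {h f v w : Tm S}

/-- The left-hand side evaluates both `f v` and `f w`, to `v'` and `w'` say; parametricity is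
applied to the relation consisting of `(v', v)` and `(w', w)`. -/
theorem logRel_choice_app (f_val : IsValue f) (v_val : IsValue v) (w_val : IsValue w)
    (h_ty : HasType 0 [] h choiceTy) (f_ty : HasType 0 [] f (.arr τ σ))
    (v_ty : HasType 0 [] v τ) (w_ty : HasType 0 [] w τ) :
    LogRel [] (.app (.app (.tapp h σ) (.app f v)) (.app f w))
      (.app f (.app (.app (.tapp h τ) v) w)) σ := by
  intro ρ hρ θ₁ θ₂ k γ₁ γ₂ hγ n hn r hr
  have hfv := (f_ty.app v_ty).logRel ρ hρ θ₁ θ₂ k γ₁ γ₂ hγ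
  have hfw := (f_ty.app w_ty).logRel ρ hρ θ₁ θ₂ k γ₁ γ₂ hγ
  have hh := h_ty.logRel ρ hρ θ₁ θ₂ k γ₁ γ₂ hγ
  have hf₂ := (f_val.subst hγ.right (θ := θ₂)).eval
  simp only [Tm.subst] at *
  cases hr with
  | @app _ _ _ _ w' _ _ n₂ n₃ hg hw hr =>
    cases hg with
    | @app _ _ _ _ v' _ m₁ m₂ m₃ hg hv hg' =>
      obtain ⟨_, v'', hv₂, hvv⟩ := hfv m₂ (by omega) _ hv
      obtain ⟨_, w'', hw₂, hww⟩ := hfw n₂ (by omega) _ hw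
      obtain ⟨_, u, hu, hru⟩ := hh.choice hρ (σ.subst θ₁) (τ.subst θ₂) hv.isValue
        (v_val.subst hγ.right (θ := θ₂)) hw.isValue (w_val.subst hγ.right (θ := θ₂))
        (m₁ + 0 + m₃ + 0 + n₃) (by omega) r
        (.app (.app hg hv.isValue.eval hg') hw.isValue.eval hr)
      obtain ⟨rfl, rfl⟩ | ⟨rfl, rfl⟩ := hru
      · obtain ⟨l, hl⟩ := hf₂.app_of_app hu hv₂
        exact ⟨l, v'', hl, (valRel_good σ hρ).mono (by omega) hvv⟩
      · obtain ⟨l, hl⟩ := hf₂.app_of_app hu hw₂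
        exact ⟨l, w'', hl, (valRel_good σ hρ).mono (by omega) hww⟩

/-- A closed well-typed term that terminates still does so under any value substitution. -/
theorem HasType.eval_subst {e : Tm S} (he : HasType 0 [] e τ) (ht : Terminates e)
    (θ : ℕ → Ty) {γ : ℕ → Tm S} (hγ : ∀ x, IsValue (γ x)) :
    ∃ n u, Eval (e.subst θ γ) n u := by
  obtain ⟨n, u, hu⟩ := terminates_iff_eval.1 ht
  have := he.logRel _ (fun _ => emptyRel_good) Ty.var θ n Tm.var γ (.nil .var hγ) n le_rfl u
  rw [Tm.subst_var] at this
  obtain ⟨m, u', hu', -⟩ := this hu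
  exact ⟨m, u', hu'⟩

/-- The left-hand side calls `f` only on the value chosen by `h`, so the evaluations of `f v` and
`f w` on the right-hand side, to `v'` and `w'` say, have to be assumed; parametricity is applied
to the relation consisting of `(v, v')` and `(w, w')`. -/
theorem logRel_app_choice (v_val : IsValue v) (w_val : IsValue w)
    (h_ty : HasType 0 [] h choiceTy) (f_ty : HasType 0 [] f (.arr τ σ))
    (v_ty : HasType 0 [] v τ) (w_ty : HasType 0 [] w τ)
    (hv : Terminates (.app f v)) (hw : Terminates (.app f w)) :
    LogRel [] (.app f (.app (.app (.tapp h τ) v) w))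
      (.app (.app (.tapp h σ) (.app f v)) (.app f w)) σ := by
  intro ρ hρ θ₁ θ₂ k γ₁ γ₂ hγ n hn r hr
  have hfv := (f_ty.app v_ty).logRel ρ hρ θ₁ θ₂ k γ₁ γ₂ hγ
  have hfw := (f_ty.app w_ty).logRel ρ hρ θ₁ θ₂ k γ₁ γ₂ hγ
  have hh := h_ty.logRel ρ hρ θ₁ θ₂ k γ₁ γ₂ hγ
  obtain ⟨_, v', hv'⟩ := (f_ty.app v_ty).eval_subst hv θ₂ hγ.right
  obtain ⟨_, w', hw'⟩ := (f_ty.app w_ty).eval_subst hw θ₂ hγ.right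
  simp only [Tm.subst] at *
  cases hr with
  | @app _ _ _ b u _ n₁ n₂ n₃ hf hu hr =>
    obtain ⟨_, u', hu', huu⟩ := hh.choice hρ (τ.subst θ₁) (σ.subst θ₂)
      (v_val.subst hγ.left (θ := θ₁)) hv'.isValue (w_val.subst hγ.left (θ := θ₁)) hw'.isValue
      n₂ (by omega) u hu
    -- The call-by-value evaluation of the arguments `f v` and `f w` precedes that of the choice.
    have hchoice : ∃ l, Eval (.app (.app (.tapp (h.subst θ₂ γ₂) (σ.subst θ₂))
        (.app (f.subst θ₂ γ₂) (v.subst θ₂ γ₂))) (.app (f.subst θ₂ γ₂) (w.subst θ₂ γ₂))) l u' := by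
      cases hu' with
      | app hg hw'' hb =>
        obtain ⟨-, rfl⟩ := hw'.isValue.eval_inv hw''
        cases hg with
        | app hg hv'' hb' =>
          obtain ⟨-, rfl⟩ := hv'.isValue.eval_inv hv''
          exact ⟨_, .app (.app hg hv' hb') hw' hb⟩
    obtain ⟨l, hl⟩ := hchoice
    obtain ⟨rfl, rfl⟩ | ⟨rfl, rfl⟩ := huu
    · obtain ⟨_, v'', hv'', hvv⟩ := hfv (n₁ + 0 + n₃) (by omega) r (.app hf hu.isValue.eval hr)
      rw [hv'.det hv''] at hvv
      exact ⟨l, _, hl, (valRel_good σ hρ).mono (by omega) hvv⟩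
    · obtain ⟨_, w'', hw'', hww⟩ := hfw (n₁ + 0 + n₃) (by omega) r (.app hf hu.isValue.eval hr)
      rw [hw'.det hw''] at hww
      exact ⟨l, _, hl, (valRel_good σ hρ).mono (by omega) hww⟩

theorem hasType_choice (hσ : σ.WF 0) (h_ty : HasType 0 [] h choiceTy) (hv : HasType 0 [] v σ)
    (hw : HasType 0 [] w σ) : HasType 0 [] (.app (.app (.tapp h σ) v) w) σ :=
  .app (.app (.tapp h_ty hσ) hv) hw

end Choice

end FMu

theorem mainTheorem12 (S : FMu.PrimSig) (τ σ : FMu.Ty) (hτ : τ.WF 0) (hσ : σ.WF 0)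
    (h f v w : FMu.Tm S)
    (h_val : FMu.IsValue h) (f_val : FMu.IsValue f)
    (v_val : FMu.IsValue v) (w_val : FMu.IsValue w)
    (h_ty : FMu.HasType 0 [] h FMu.choiceTy) (f_ty : FMu.HasType 0 [] f (.arr τ σ))
    (v_ty : FMu.HasType 0 [] v τ) (w_ty : FMu.HasType 0 [] w τ) :
    FMu.CtxApprox 0 []
        (.app (.app (.tapp h σ) (.app f v)) (.app f w))
        (.app f (.app (.app (.tapp h τ) v) w)) σ ∧
      (FMu.Total f τ →
        FMu.CtxApprox 0 []
          (.app f (.app (.app (.tapp h τ) v) w))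
          (.app (.app (.tapp h σ) (.app f v)) (.app f w)) σ) := by
  have hσ_ty := FMu.hasType_choice hσ h_ty (f_ty.app v_ty) (f_ty.app w_ty)
  have hτ_ty := f_ty.app (FMu.hasType_choice hτ h_ty v_ty w_ty)
  exact ⟨(FMu.logRel_choice_app f_val v_val w_val h_ty f_ty v_ty w_ty).ctxApprox hσ_ty hτ_ty,
    fun hf => (FMu.logRel_app_choice v_val w_val h_ty f_ty v_ty w_ty (hf v v_ty v_val)
      (hf w w_ty w_val)).ctxApprox hτ_ty hσ_ty⟩
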